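/- Words are finite strings, sequences are infinite strings $u_0u_1u_2\cdots$ over a finite alphabet, and $\mathcal L(\mathbf v)$ is the set of (finite) factors of a sequence $\mathbf v$. For $d\ge 3$ let $\varphi_d$ be the morphism on $\{0,1,\dots,d-1\}^*$ with $\varphi_d(i)=0(i+1)$ for $0\le i\le d-2$ and $\varphi_d(d-1)=0(d-1)(d-1)$, and let $\mathbf u_d=\lim_n\varphi_d^n(0)$ be its fixed point. For a factor $w$ of a sequence $\mathbf v$ over an alphabet $\mathcal B$ let $\mathrm{Lext}(w)=\{iw\in\mathcal L(\mathbf v): i\in\mathcal B\}$, $\mathrm{Rext}(w)=\{wi\in\mathcal L(\mathbf v): i\in\mathcal B\}$, $\mathrm{Bext}(w)=\{iwj\in\mathcal L(\mathbf v): i,j\in\mathcal B\}$, $\mathrm b(w)=\#\mathrm{Bext}(w)-\#\mathrm{Lext}(w)-\#\mathrm{Rext}(w)+1$ and, if $w$ is a palindrome, $\mathrm{Pext}(w)=\{iwi\in\mathcal L(\mathbf v): i\in\mathcal B\}$; $w$ is bispecial if $\#\mathrm{Lext}(w)\ge 2$ and $\#\mathrm{Rext}(w)\ge 2$. A word $w$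 is rich if it has exactly $|w|+1$ distinct palindromic factors (including the empty word), and a sequence is rich if all its factors are rich. **Proposition.** Let $d\ge 3$ and let $\eta:\{0,1,\dots,d-1\}^*\to\mathcal B^*$ be a morphism of class $P_{\mathrm{ret}}$ with common palindrome $p$, i.e. $\eta$ is injective, $p\in\mathcal B^*$ is a palindrome, and for every letter $i$ we have $\eta(i)=pq_i$ with $q_i$ a palindrome, and $\eta(i)p$ is a complete return word to $p$ (that is, $\eta(i)$ is non-empty and $p$ occurs in $\eta(i)p$ exactly twice, once as a prefix and once as a suffix). Suppose that every bispecial factor $w$ of $\eta(\mathbf u_d)$ that does not contain $p$ as a factor satisfies - $\mathrm b(w)=0$ if $w$ is not a palindrome; - $\mathrm b(w)=\#\mathrm{Pext}(w)-1$ if $w$ is a palindrome. Then $\eta(\mathbf u_d)$ is rich. -/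

import Mathlib

namespace RichWords

/-! ### Words and sequences

Words over `A` are lists over `A`, sequences are functions `ℕ → A`. -/

/-- The word `u_j u_{j+1} ⋯ u_{j+n-1}`. -/
def block {A : Type*} (u : ℕ → A) (j n : ℕ) : List A :=
  (List.range n).map fun k => u (j + k)

/-- The language of a sequence: the set of its factors. -/
def language {A : Type*} (u : ℕ → A) : Set (List A) :=
  {w | ∃ j : ℕ, w = block u j w.length}

/-- `j` is an occurrence of the word `p` in the word `z`. -/
def OccursAt {A : Type*} (p z : List A) (j : ℕ) : Prop :=
  ∃ s t : List A, z = s ++ p ++ t ∧ s.length = j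

/-- `z` is a complete return word to `p`: `z = r ++ p` with `r` non-empty, and `p` occurs in `z`
exactly twice, once as a prefix and once as a suffix. -/
def IsCompleteReturn {A : Type*} (p z : List A) : Prop :=
  ∃ r : List A, r ≠ [] ∧ z = r ++ p ∧ ∀ j : ℕ, OccursAt p z j ↔ (j = 0 ∨ j = r.length)

/-! ### Extensions, bispecial factors, bilateral order -/

/-- Left extensions of `w`. -/
def Lext {A : Type*} (u : ℕ → A) (w : List A) : Set (List A) :=
  {z | z ∈ language u ∧ ∃ i : A, z = i :: w}

/-- Right extensions of `w`. -/
def Rext {A : Type*} (u : ℕ → A) (w : List A) : Set (List A) :=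
  {z | z ∈ language u ∧ ∃ i : A, z = w ++ [i]}

/-- Both-sided extensions of `w`. -/
def Bext {A : Type*} (u : ℕ → A) (w : List A) : Set (List A) :=
  {z | z ∈ language u ∧ ∃ i j : A, z = i :: (w ++ [j])}

/-- Palindromic extensions of `w`. -/
def Pext {A : Type*} (u : ℕ → A) (w : List A) : Set (List A) :=
  {z | z ∈ language u ∧ ∃ i : A, z = i :: (w ++ [i])}

/-- `w` is a left special factor of `u`. -/
def IsLeftSpecial {A : Type*} (u : ℕ → A) (w : List A) : Prop :=
  w ∈ language u ∧ ∃ i j : A, i ≠ j ∧ i :: w ∈ language u ∧ j :: w ∈ language u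

/-- `w` is a right special factor of `u`. -/
def IsRightSpecial {A : Type*} (u : ℕ → A) (w : List A) : Prop :=
  w ∈ language u ∧ ∃ i j : A, i ≠ j ∧ w ++ [i] ∈ language u ∧ w ++ [j] ∈ language u

/-- `w` is a bispecial factor of `u`. -/
def IsBispecial {A : Type*} (u : ℕ → A) (w : List A) : Prop :=
  IsLeftSpecial u w ∧ IsRightSpecial u w

/-- The bilateral order `b(w) = #Bext(w) - #Lext(w) - #Rext(w) + 1`. -/
noncomputable def bilateralOrder {A : Type*} (u : ℕ → A) (w : List A) : ℤ :=
  ((Bext u w).ncard : ℤ) - ((Lext u w).ncard : ℤ) - ((Rext u w).ncard : ℤ) + 1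

/-! ### Richness -/

/-- A word `w` is rich if it has exactly `|w| + 1` distinct palindromic factors (the empty word
included). -/
def IsRichWord {A : Type*} (w : List A) : Prop :=
  {x : List A | x <:+: w ∧ x.Palindrome}.ncard = w.length + 1

/-- A sequence is rich if each of its factors is rich. -/
def IsRich {A : Type*} (u : ℕ → A) : Prop :=
  ∀ w ∈ language u, IsRichWord w

/-! ### Morphisms

A morphism of free monoids is given by its values on letters. -/

/-- The morphism with letter images `σ`, applied to a word. -/
def onWord {A B : Type*} (σ : A → List B) (w : List A) : List B :=
  w.flatMap σ

theorem le_length_onWord {A B : Type*} (σ : A → List B) (c : ℕ) (h : ∀ a, c ≤ (σ a).length)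
    (w : List A) : c * w.length ≤ (onWord σ w).length := by
  induction w with
  | nil => simp
  | cons a w ih =>
    have := h a
    simp only [onWord, List.flatMap_cons, List.length_append, List.length_cons] at ih ⊢
    linarith

theorem lt_length_onWord_block {A B : Type*} (σ : A → List B) (h : ∀ a, σ a ≠ []) (u : ℕ → A)
    (n : ℕ) : n < (onWord σ (block u 0 (n + 1))).length := by
  have := le_length_onWord σ 1 (fun a => List.length_pos_iff.mpr (h a)) (block u 0 (n + 1))
  simp only [block, List.length_map, List.length_range] at this ⊢
  omega

/-- The image `σ(u_0) σ(u_1) σ(u_2) ⋯` of a sequence under a morphism that erases no letter. Its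
`n`-th letter is the `n`-th letter of `σ(u_0 ⋯ u_n)`, a word of length at least `n + 1`. -/
def onSeq {A B : Type*} (σ : A → List B) (h : ∀ a, σ a ≠ []) (u : ℕ → A) : ℕ → B :=
  fun n => (onWord σ (block u 0 (n + 1)))[n]'(lt_length_onWord_block σ h u n)

/-- The morphism with letter images `η` is of class `P_ret`, with common palindrome `p`. -/
structure IsClassPret {A B : Type*} (η : A → List B) (p : List B) : Prop where
  injective : Function.Injective (onWord η)
  palindrome : p.Palindrome
  eq_append : ∀ i, ∃ q : List B, q.Palindrome ∧ η i = p ++ q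
  completeReturn : ∀ i, IsCompleteReturn p (η i ++ p)

theorem IsClassPret.ne_nil {A B : Type*} {η : A → List B} {p : List B} (h : IsClassPret η p) :
    ∀ i, η i ≠ [] := by
  intro i hi
  obtain ⟨r, hr, hz, -⟩ := h.completeReturn i
  rw [List.append_cancel_right hz] at hi
  exact hr hi

/-! ### The sequence `u_d` -/

/-- The morphism `φ_d` on `{0, …, d-1}`: `i ↦ 0 (i+1)` for `i < d - 1`, and
`d-1 ↦ 0 (d-1) (d-1)`. -/
def phi (d : ℕ) (i : Fin d) : List (Fin d) :=
  if h : (i : ℕ) + 1 < d then [⟨0, i.pos⟩, ⟨(i : ℕ) + 1, h⟩] else [⟨0, i.pos⟩, i, i]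

theorem two_le_length_phi (d : ℕ) (i : Fin d) : 2 ≤ (phi d i).length := by
  unfold phi
  split <;> simp

theorem phi_ne_nil (d : ℕ) (i : Fin d) : phi d i ≠ [] := by
  have := two_le_length_phi d i
  intro h
  simp [h] at this

/-- The word `φ_d^n(0)`. -/
def phiIter (d : ℕ) (hd : 3 ≤ d) (n : ℕ) : List (Fin d) :=
  (onWord (phi d))^[n] [⟨0, by omega⟩]

theorem phiIter_succ (d : ℕ) (hd : 3 ≤ d) (n : ℕ) :
    phiIter d hd (n + 1) = onWord (phi d) (phiIter d hd n) :=
  Function.iterate_succ_apply' _ _ _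

theorem lt_length_phiIter (d : ℕ) (hd : 3 ≤ d) (n : ℕ) : n < (phiIter d hd n).length := by
  induction n with
  | zero => simp [phiIter]
  | succ n ih =>
    rw [phiIter_succ]
    have := le_length_onWord (phi d) 2 (two_le_length_phi d) (phiIter d hd n)
    omega

/-- The sequence `u_d`, the fixed point of `φ_d`: the limit of the words `φ_d^n(0)`, each of which
is a prefix of the next one. -/
def uSeq (d : ℕ) (hd : 3 ≤ d) : ℕ → Fin d :=
  fun n => (phiIter d hd n)[n]'(lt_length_phiIter d hd n)

theorem onWord_prefix {A B : Type*} (σ : A → List B) {v w : List A} (h : v <+: w) :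
    onWord σ v <+: onWord σ w := by
  obtain ⟨t, rfl⟩ := h
  exact ⟨onWord σ t, by simp [onWord]⟩

theorem phiIter_prefix (d : ℕ) (hd : 3 ≤ d) {m n : ℕ} (h : m ≤ n) :
    phiIter d hd m <+: phiIter d hd n := by
  have step : ∀ k, phiIter d hd k <+: phiIter d hd (k + 1) := by
    intro k
    induction k with
    | zero =>
      refine ⟨[⟨1, by omega⟩], ?_⟩
      have : 1 < d := by omega
      simp [phiIter, onWord, phi, this]
    | succ k ih =>
      rw [phiIter_succ, phiIter_succ d hd (k + 1)]
      exact onWord_prefix _ ih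
  induction n, h using Nat.le_induction with
  | base => exact List.prefix_refl _
  | succ n _ ih => exact ih.trans (step n)

theorem uSeq_eq (d : ℕ) (hd : 3 ≤ d) (n k : ℕ) (hk : k < (phiIter d hd n).length) :
    uSeq d hd k = (phiIter d hd n)[k] := by
  rcases le_total k n with h | h
  · exact (phiIter_prefix d hd h).getElem _
  · exact ((phiIter_prefix d hd h).getElem hk).symm

theorem block_uSeq_prefix (d : ℕ) (hd : 3 ≤ d) (n : ℕ) :
    block (uSeq d hd) 0 (n + 1) <+: phiIter d hd n := by
  have hl := lt_length_phiIter d hd n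
  have : block (uSeq d hd) 0 (n + 1) = (phiIter d hd n).take (n + 1) := by
    apply List.ext_getElem
    · simp [block]; omega
    · intro k h1 h2
      simp only [block, List.getElem_map, List.getElem_range, List.getElem_take, zero_add]
      exact uSeq_eq d hd n k _
  rw [this]
  exact List.take_prefix _ _

/-- `u_d` is a fixed point of `φ_d`. -/
theorem onSeq_phi_uSeq (d : ℕ) (hd : 3 ≤ d) :
    onSeq (phi d) (phi_ne_nil d) (uSeq d hd) = uSeq d hd := by
  funext n
  have hp := onWord_prefix (phi d) (block_uSeq_prefix d hd n)
  rw [← phiIter_succ] at hp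
  have hn := lt_length_onWord_block (phi d) (phi_ne_nil d) (uSeq d hd) n
  rw [uSeq_eq d hd (n + 1) n (hn.trans_le hp.length_le)]
  exact hp.getElem hn

end RichWords

/-!
Let `u` be closed under reversal. The sum of `b(w)` over the factors `w` of length `n` is the
second difference of the factor complexity, so if `b(w) = 0` for non-palindromic and
`b(w) = #Pext(w) - 1` for palindromic factors, then induction on `n` gives
`P(n) + P(n + 1) = C(n + 1) - C(n) + 2` for the palindromic complexity `P` and the factor
complexity `C`. Hence the graph whose vertices are the factors of length `n` up to reversal, and
whose edges are the non-palindromic factors of length `n + 1` up to reversal, has one more vertex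
than edges. It is traversed by `u`, so it is a tree, and a walk in a tree returns to a vertex
through the edge by which it left. Applied to the first and last mismatch of a complete return to
a palindrome, this shows that such a return is itself a palindrome, which is richness.

It remains to find `b(w)` for bispecial factors `w` of `η(u_d)` that contain `p`. These have the
form `s η(x) p tᴿ`, and the letters extending `w` are obtained from those extending `x` by
replacing `i` with the letter that precedes the suffix `s`, respectively `t`, of `η(i)`. Knowing
`b(x)` is not enough to find `b(w)`, but the shape of the bipartite extension graph is: stars with
some loops stay such, or become double stars when `s ≠ t`, while double stars stay double stars.
These shapes have the required `b`. Finally `u_d = φ_d(u_d)`, and `φ_d` is itself of class `P_ret`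
with common palindrome `0`, so the shapes for `u_d` follow by descent from its bispecial factors
without `0`, which are the empty word and `d - 1`.
-/

namespace RichWords

/-! ### Factors -/

section Language

variable {A : Type*} {u : ℕ → A}

@[simp]
theorem length_block (u : ℕ → A) (j n : ℕ) : (block u j n).length = n := by
  simp [block]

theorem block_add (u : ℕ → A) (j m n : ℕ) :
    block u j (m + n) = block u j m ++ block u (j + m) n := by
  simp [block, List.range_add, add_assoc]

theorem block_one (u : ℕ → A) (j : ℕ) : block u j 1 = [u j] := by
  simp [block]

theorem block_succ (u : ℕ → A) (j n : ℕ) : block u j (n + 1) = block u j n ++ [u (j + n)] := by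
  rw [block_add, block_one]

theorem block_succ' (u : ℕ → A) (j n : ℕ) : block u j (n + 1) = u j :: block u (j + 1) n := by
  rw [add_comm, block_add, block_one, List.singleton_append]

theorem block_mem_language (u : ℕ → A) (j n : ℕ) : block u j n ∈ language u :=
  ⟨j, by simp⟩

theorem infix_block_iff {w : List A} {j n : ℕ} :
    w <:+: block u j n ↔ ∃ i, i + w.length ≤ n ∧ w = block u (j + i) w.length := by
  constructor
  · rintro ⟨s, t, h⟩
    have hlen : s.length + w.length + t.length = n := by
      simpa [add_assoc] using congrArg List.length h
    rw [← hlen, block_add, block_add] at h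
    exact ⟨s.length, by omega,
      (List.append_inj (List.append_inj h (by simp)).1 (by simp)).2⟩
  · rintro ⟨i, hi, hw⟩
    obtain ⟨k, rfl⟩ := Nat.exists_eq_add_of_le hi
    rw [block_add, block_add, ← hw]
    exact List.infix_append _ _ _

theorem mem_language_of_infix {w z : List A} (hz : z ∈ language u) (h : w <:+: z) :
    w ∈ language u := by
  obtain ⟨j, hj⟩ := hz
  rw [hj] at h
  obtain ⟨i, -, hi⟩ := infix_block_iff.mp h
  exact ⟨_, hi⟩

theorem exists_infix_block_zero {w : List A} (hw : w ∈ language u) : ∃ n, w <:+: block u 0 n := by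
  obtain ⟨j, hj⟩ := hw
  exact ⟨j + w.length, infix_block_iff.mpr ⟨j, le_rfl, by rwa [zero_add]⟩⟩

theorem exists_append_singleton_mem_language {w : List A} (hw : w ∈ language u) :
    ∃ b, w ++ [b] ∈ language u := by
  obtain ⟨j, hj⟩ := hw
  refine ⟨u (j + w.length), ?_⟩
  rw [hj, length_block, ← block_succ]
  exact block_mem_language _ _ _

/-- Sequences whose language is closed under reversal. -/
def IsClosedUnderReversal (u : ℕ → A) : Prop :=
  ∀ w ∈ language u, w.reverse ∈ language u

theorem IsClosedUnderReversal.reverse_mem_iff (hu : IsClosedUnderReversal u) {w : List A} :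
    w.reverse ∈ language u ↔ w ∈ language u :=
  ⟨fun h => w.reverse_reverse ▸ hu _ h, hu w⟩

theorem IsClosedUnderReversal.exists_cons_mem_language (hu : IsClosedUnderReversal u) {w : List A}
    (hw : w ∈ language u) : ∃ a, a :: w ∈ language u := by
  obtain ⟨a, ha⟩ := exists_append_singleton_mem_language (hu w hw)
  exact ⟨a, by simpa using hu _ ha⟩

theorem exists_eq_cons_append_singleton {z : List A} {n : ℕ} (h : z.length = n + 2) :
    ∃ a w b, z = a :: (w ++ [b]) ∧ w.length = n := by
  obtain ⟨a, y, rfl⟩ := List.exists_cons_of_length_eq_add_one h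
  rcases List.eq_nil_or_concat' y with rfl | ⟨w, b, rfl⟩
  · simp at h
  · exact ⟨a, w, b, rfl, by simpa using h⟩

theorem palindrome_cons_append_singleton_iff {w : List A} {a b : A} :
    (a :: (w ++ [b])).Palindrome ↔ a = b ∧ w.Palindrome := by
  simp only [List.Palindrome.iff_reverse_eq, List.reverse_cons, List.reverse_append,
    List.reverse_nil, List.nil_append, List.cons_append, List.cons.injEq]
  constructor
  · rintro ⟨rfl, h⟩
    exact ⟨rfl, List.append_cancel_right h⟩
  · rintro ⟨rfl, h⟩
    exact ⟨rfl, by rw [h]⟩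

theorem isCompleteReturn_iff {v z : List A} :
    IsCompleteReturn v z ↔ v ≠ z ∧ v <+: z ∧ v <:+ z ∧
      ∀ x y, z = x ++ v ++ y → x = [] ∨ y = [] := by
  constructor
  · rintro ⟨r, hr, rfl, hocc⟩
    refine ⟨by simpa using hr, ?_, List.suffix_append _ _, fun x y hxy => ?_⟩
    · obtain ⟨x, y, hxy, hx⟩ := (hocc 0).mpr (Or.inl rfl)
      rw [List.length_eq_zero_iff.mp hx] at hxy
      exact ⟨y, hxy.symm⟩
    · have hlen := congrArg List.length hxy
      simp only [List.length_append] at hlen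
      rw [← List.length_eq_zero_iff, ← List.length_eq_zero_iff]
      have := (hocc _).mp ⟨x, y, hxy, rfl⟩
      omega
  · rintro ⟨hne, ⟨t, ht⟩, ⟨r, rfl⟩, hocc⟩
    refine ⟨r, by simpa using hne, rfl, fun j => ⟨?_, ?_⟩⟩
    · rintro ⟨x, y, hxy, rfl⟩
      have hlen := congrArg List.length hxy
      simp only [List.length_append] at hlen
      rcases hocc x y hxy with rfl | rfl
      · simp
      · simp only [List.length_nil] at hlen
        omega
    · rintro (rfl | rfl)
      · exact ⟨[], t, by simpa using ht.symm, rfl⟩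
      · exact ⟨r, [], by simp, rfl⟩

end Language

/-! ### Palindromic complete returns -/

section Returns

variable {A : Type*} {u : ℕ → A}

theorem finite_palindromic_infixes (w : List A) : {x | x <:+: w ∧ x.Palindrome}.Finite := by
  classical
  refine w.sublists.toFinset.finite_toSet.subset fun x hx => ?_
  simpa using hx.1.sublist

theorem exists_isCompleteReturn_suffix {s w : List A} {a : A} (hs : s <:+ w ++ [a])
    (hsw : s <:+: w) : ∃ z, z <:+ w ++ [a] ∧ IsCompleteReturn s z := by
  classical
  have hex : ∃ n, ∃ y, y ≠ [] ∧ s ++ y <:+ w ++ [a] ∧ y.length = n := by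
    obtain ⟨x, y, rfl⟩ := hsw
    exact ⟨_, y ++ [a], by simp, ⟨x, by simp⟩, rfl⟩
  obtain ⟨y, hy, hsuf, hlen⟩ := Nat.find_spec hex
  refine ⟨s ++ y, hsuf, isCompleteReturn_iff.mpr ⟨by simpa using hy.symm, List.prefix_append _ _,
    List.suffix_of_suffix_length_le hs hsuf (by simp), fun x t hxt => ?_⟩⟩
  by_contra! hne
  have hx := List.length_pos_iff.mpr hne.1
  have hlen' := congrArg List.length hxt
  simp only [List.length_append] at hlen'
  refine Nat.find_min hex (m := t.length) (by omega) ⟨t, hne.2, ?_, rfl⟩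
  exact List.IsSuffix.trans ⟨x, by simp [hxt]⟩ hsuf

theorem exists_longest_palindromic_suffix (w : List A) : ∃ s, s <:+ w ∧ s.Palindrome ∧
    ∀ x, x <:+ w → x.Palindrome → x.length ≤ s.length := by
  have hfin : {x | x <:+ w ∧ x.Palindrome}.Finite :=
    (finite_palindromic_infixes w).subset fun x hx => ⟨hx.1.isInfix, hx.2⟩
  obtain ⟨s, hs, hmax⟩ := Set.exists_max_image _ List.length hfin
    ⟨[], List.nil_suffix, List.Palindrome.nil⟩
  exact ⟨s, hs.1, hs.2, fun x hx hxp => hmax x ⟨hx, hxp⟩⟩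

theorem palindromic_infixes_append_singleton {s w : List A} {a : A} (hs : s <:+ w ++ [a])
    (hsp : s.Palindrome) (hmax : ∀ x, x <:+ w ++ [a] → x.Palindrome → x.length ≤ s.length) :
    {x | x <:+: w ++ [a] ∧ x.Palindrome} = insert s {x | x <:+: w ∧ x.Palindrome} := by
  refine Set.Subset.antisymm ?_ (Set.insert_subset ⟨hs.isInfix, hsp⟩ fun x hx =>
    ⟨hx.1.trans (List.prefix_append _ _).isInfix, hx.2⟩)
  rintro x ⟨hx, hxp⟩
  rcases List.infix_concat_iff.mp hx with hxs | hxw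
  swap
  · exact Or.inr ⟨hxw, hxp⟩
  have hxs' : x <:+ s := List.suffix_of_suffix_length_le hxs hs (hmax x hxs hxp)
  -- A shorter palindromic suffix is mirrored by `s` to an earlier occurrence.
  have hxs'' : x <+: s := by
    have := List.reverse_prefix.mpr hxs'
    rwa [hxp.reverse_eq, hsp.reverse_eq] at this
  rcases List.suffix_concat_iff.mp hs with rfl | ⟨t, rfl, ht⟩
  · exact Or.inl (List.prefix_nil.mp hxs'')
  · rcases List.prefix_concat_iff.mp hxs'' with rfl | hxt
    · exact Or.inl (by simp)
    · exact Or.inr ⟨hxt.isInfix.trans ht.isInfix, hxp⟩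

theorem isRichWord_of_palindromic_returns {w : List A}
    (h : ∀ v z, v.Palindrome → z <:+: w → IsCompleteReturn v z → z.Palindrome) :
    IsRichWord w := by
  induction w using List.reverseRecOn with
  | nil =>
    have : {x : List A | x <:+: [] ∧ x.Palindrome} = {[]} := by
      ext x
      simp only [List.infix_nil, Set.mem_ofPred_eq, Set.mem_singleton_iff, and_iff_left_iff_imp]
      rintro rfl
      exact List.Palindrome.nil
    rw [IsRichWord, this, Set.ncard_singleton, List.length_nil]
  | append_singleton w a ih =>
    obtain ⟨s, hs, hsp, hmax⟩ := exists_longest_palindromic_suffix (w ++ [a])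
    have hnew : ¬ s <:+: w := by
      intro hsw
      obtain ⟨z, hz, hret⟩ := exists_isCompleteReturn_suffix hs hsw
      obtain ⟨hne, hpre, -, -⟩ := isCompleteReturn_iff.mp hret
      have hle := hmax z hz (h s z hsp hz.isInfix hret)
      exact hne (hpre.eq_of_length (hpre.length_le.antisymm hle))
    have hw : IsRichWord w :=
      ih fun v z hv hz => h v z hv (hz.trans (List.prefix_append _ _).isInfix)
    rw [IsRichWord] at hw ⊢
    rw [palindromic_infixes_append_singleton hs hsp hmax,
      Set.ncard_insert_of_notMem (fun h => hnew h.1) (finite_palindromic_infixes w), hw,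
      List.length_append, List.length_singleton]

end Returns

/-! ### Extension relations -/

section Extensions

variable {A : Type*} {u : ℕ → A}

/-- The extension relation of `w`, or extension graph: the pairs of letters `(a, b)` for which
`a w b` is a factor of `u`. -/
def extRel (u : ℕ → A) (w : List A) : SetRel A A :=
  {q | q.1 :: (w ++ [q.2]) ∈ language u}

/-- The order `#R - #dom R - #cod R + 1` of a relation, which is the bilateral order of `w` if `R`
is the extension relation of `w`. -/
noncomputable def relOrder (R : SetRel A A) : ℤ :=
  R.ncard - R.dom.ncard - R.cod.ncard + 1

theorem relOrder_inv (R : SetRel A A) : relOrder R.inv = relOrder R := by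
  have : R.inv.ncard = R.ncard :=
    Set.ncard_preimage_of_injective_subset_range Prod.swap_injective
      (by simp [Prod.swap_surjective.range_eq])
  rw [relOrder, relOrder, this, SetRel.dom_inv, SetRel.cod_inv]
  ring

theorem relOrder_eq_zero_of_subsingleton_dom {R : SetRel A A} (hR : R.Nonempty)
    (h : R.dom.Subsingleton) : relOrder R = 0 := by
  obtain ⟨⟨a, b⟩, hab⟩ := hR
  have hdom : R.dom = {a} := h.eq_singleton_of_mem ⟨b, hab⟩
  have himage : R = Prod.mk a '' R.cod := by
    ext ⟨x, y⟩
    constructor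
    · intro hxy
      obtain rfl : x = a := h ⟨y, hxy⟩ ⟨b, hab⟩
      exact ⟨y, ⟨x, hxy⟩, rfl⟩
    · rintro ⟨_, ⟨z, hz⟩, ⟨⟩⟩
      obtain rfl : z = a := h ⟨y, hz⟩ ⟨b, hab⟩
      exact hz
  have hcard : R.ncard = R.cod.ncard := by
    conv_lhs => rw [himage]
    exact Set.ncard_image_of_injective _ (Prod.mk_right_injective a)
  rw [relOrder, hdom, hcard, Set.ncard_singleton]
  push_cast
  ring

theorem relOrder_eq_zero_of_subsingleton {R : SetRel A A} (hR : R.Nonempty)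
    (h : R.dom.Subsingleton ∨ R.cod.Subsingleton) : relOrder R = 0 := by
  rcases h with h | h
  · exact relOrder_eq_zero_of_subsingleton_dom hR h
  · rw [← relOrder_inv]
    obtain ⟨⟨a, b⟩, hab⟩ := hR
    exact relOrder_eq_zero_of_subsingleton_dom ⟨(b, a), hab⟩ (by rwa [SetRel.dom_inv])

theorem mem_dom_extRel {w : List A} {a : A} : a ∈ (extRel u w).dom ↔ a :: w ∈ language u := by
  constructor
  · rintro ⟨b, hb⟩
    exact mem_language_of_infix hb ⟨[], [b], by simp⟩
  · exact fun h => exists_append_singleton_mem_language h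

theorem Bext_eq_image (u : ℕ → A) (w : List A) :
    Bext u w = (fun q : A × A => q.1 :: (w ++ [q.2])) '' extRel u w := by
  ext z
  constructor
  · rintro ⟨h, a, b, rfl⟩
    exact ⟨(a, b), h, rfl⟩
  · rintro ⟨⟨a, b⟩, h, rfl⟩
    exact ⟨h, a, b, rfl⟩

theorem Lext_eq_image (u : ℕ → A) (w : List A) : Lext u w = (· :: w) '' (extRel u w).dom := by
  ext z
  simp only [Lext, Set.mem_ofPred_eq, Set.mem_image, mem_dom_extRel]
  constructor
  · rintro ⟨h, a, rfl⟩
    exact ⟨a, h, rfl⟩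
  · rintro ⟨a, h, rfl⟩
    exact ⟨h, a, rfl⟩

theorem Pext_eq_image (u : ℕ → A) (w : List A) :
    Pext u w = (fun a => a :: (w ++ [a])) '' {a | (a, a) ∈ extRel u w} := by
  ext z
  constructor
  · rintro ⟨h, a, rfl⟩
    exact ⟨a, h, rfl⟩
  · rintro ⟨a, h, rfl⟩
    exact ⟨h, a, rfl⟩

theorem ncard_Pext (u : ℕ → A) (w : List A) :
    (Pext u w).ncard = {a | (a, a) ∈ extRel u w}.ncard := by
  rw [Pext_eq_image, Set.ncard_image_of_injective _ fun a b h => (List.cons.inj h).1]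

/-- The bilateral orders of the factors of a rich sequence: `0` for `w` not a palindrome, and
`#Pext(w) - 1` for `w` a palindrome. -/
def HasRichOrder (u : ℕ → A) (w : List A) : Prop :=
  (¬ w.Palindrome → bilateralOrder u w = 0) ∧
    (w.Palindrome → bilateralOrder u w = ((Pext u w).ncard : ℤ) - 1)

namespace IsClosedUnderReversal

theorem mem_cod_extRel (hu : IsClosedUnderReversal u) {w : List A} {b : A} :
    b ∈ (extRel u w).cod ↔ w ++ [b] ∈ language u := by
  constructor
  · rintro ⟨a, ha⟩
    exact mem_language_of_infix ha (List.suffix_cons _ _).isInfix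
  · exact fun h => hu.exists_cons_mem_language h

theorem Rext_eq_image (hu : IsClosedUnderReversal u) (w : List A) :
    Rext u w = (fun b => w ++ [b]) '' (extRel u w).cod := by
  ext z
  simp only [Rext, Set.mem_ofPred_eq, Set.mem_image, hu.mem_cod_extRel]
  constructor
  · rintro ⟨h, b, rfl⟩
    exact ⟨b, h, rfl⟩
  · rintro ⟨b, h, rfl⟩
    exact ⟨h, b, rfl⟩

theorem bilateralOrder_eq (hu : IsClosedUnderReversal u) (w : List A) :
    bilateralOrder u w = relOrder (extRel u w) := by
  have hinj : Function.Injective fun q : A × A => q.1 :: (w ++ [q.2]) := by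
    rintro ⟨a, b⟩ ⟨c, e⟩ h
    simpa using h
  rw [bilateralOrder, relOrder, Bext_eq_image, Lext_eq_image, hu.Rext_eq_image,
    Set.ncard_image_of_injective _ hinj,
    Set.ncard_image_of_injective _ fun a b h => (List.cons.inj h).1,
    Set.ncard_image_of_injective _ fun a b h => by simpa using h]

theorem extRel_nonempty (hu : IsClosedUnderReversal u) {w : List A} (hw : w ∈ language u) :
    (extRel u w).Nonempty := by
  obtain ⟨a, ha⟩ := hu.exists_cons_mem_language hw
  obtain ⟨b, hb⟩ := exists_append_singleton_mem_language ha
  exact ⟨(a, b), hb⟩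

theorem extRel_reverse (hu : IsClosedUnderReversal u) (w : List A) :
    extRel u w.reverse = (extRel u w).inv := by
  ext ⟨a, b⟩
  have : a :: (w.reverse ++ [b]) = (b :: (w ++ [a])).reverse := by simp
  change a :: (w.reverse ++ [b]) ∈ language u ↔ b :: (w ++ [a]) ∈ language u
  rw [this, hu.reverse_mem_iff]

theorem inv_extRel_of_palindrome (hu : IsClosedUnderReversal u) {w : List A}
    (hw : w.Palindrome) : (extRel u w).inv = extRel u w := by
  rw [← hu.extRel_reverse, hw.reverse_eq]

theorem isBispecial_iff (hu : IsClosedUnderReversal u) {w : List A} :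
    IsBispecial u w ↔ (extRel u w).dom.Nontrivial ∧ (extRel u w).cod.Nontrivial := by
  constructor
  · rintro ⟨⟨-, a, a', ha, h, h'⟩, -, b, b', hb, hr, hr'⟩
    exact ⟨⟨a, mem_dom_extRel.mpr h, a', mem_dom_extRel.mpr h', ha⟩,
      ⟨b, hu.mem_cod_extRel.mpr hr, b', hu.mem_cod_extRel.mpr hr', hb⟩⟩
  · rintro ⟨⟨a, h, a', h', ha⟩, b, hr, b', hr', hb⟩
    rw [mem_dom_extRel] at h h'
    rw [hu.mem_cod_extRel] at hr hr'
    have hw : w ∈ language u := mem_language_of_infix h (List.suffix_cons _ _).isInfix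
    exact ⟨⟨hw, a, a', ha, h, h'⟩, hw, b, b', hb, hr, hr'⟩

theorem hasRichOrder_of_not_isBispecial (hu : IsClosedUnderReversal u) {w : List A}
    (hw : w ∈ language u) (h : ¬ IsBispecial u w) : HasRichOrder u w := by
  rw [hu.isBispecial_iff, not_and_or, Set.not_nontrivial_iff, Set.not_nontrivial_iff] at h
  have hzero : bilateralOrder u w = 0 := by
    rw [hu.bilateralOrder_eq, relOrder_eq_zero_of_subsingleton (hu.extRel_nonempty hw) h]
  refine ⟨fun _ => hzero, fun hp => ?_⟩
  have hinv := hu.inv_extRel_of_palindrome hp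
  have hdom : (extRel u w).dom.Subsingleton := by
    rcases h with h | h
    · exact h
    · rwa [← SetRel.dom_inv, hinv] at h
  obtain ⟨⟨a, b⟩, hab⟩ := hu.extRel_nonempty hw
  have hba : (b, a) ∈ extRel u w := by rwa [← hinv]
  obtain rfl : a = b := hdom ⟨b, hab⟩ ⟨a, hba⟩
  have hloops : {x | (x, x) ∈ extRel u w} = {a} :=
    Set.Subsingleton.eq_singleton_of_mem (fun x hx y hy => hdom ⟨x, hx⟩ ⟨y, hy⟩) hab
  rw [hzero, ncard_Pext, hloops, Set.ncard_singleton]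
  norm_num

end IsClosedUnderReversal

end Extensions

/-! ### Counting factors and palindromes -/

section Counting

open Finset

variable {A : Type*} [Finite A] {u : ℕ → A}

theorem finite_factors_of_length (u : ℕ → A) (n : ℕ) :
    {w | w ∈ language u ∧ w.length = n}.Finite :=
  (List.finite_length_eq A n).subset fun _ h => h.2

/-- The finite set of the factors of length `n`. -/
noncomputable def factors (u : ℕ → A) (n : ℕ) : Finset (List A) :=
  (finite_factors_of_length u n).toFinset

@[simp]
theorem mem_factors {w : List A} {n : ℕ} :
    w ∈ factors u n ↔ w ∈ language u ∧ w.length = n := by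
  simp [factors]

theorem block_mem_factors (u : ℕ → A) (j n : ℕ) : block u j n ∈ factors u n :=
  mem_factors.mpr ⟨block_mem_language u j n, length_block u j n⟩

open Classical in
/-- The finite set of the palindromic factors of length `n`. -/
noncomputable def palFactors (u : ℕ → A) (n : ℕ) : Finset (List A) :=
  {w ∈ factors u n | w.Palindrome}

@[simp]
theorem mem_palFactors {w : List A} {n : ℕ} :
    w ∈ palFactors u n ↔ (w ∈ language u ∧ w.length = n) ∧ w.Palindrome := by
  simp [palFactors]

theorem card_eq_sum_ncard_fiber {α β : Type*} {S : Finset α} {T : Finset β} {f : α → β}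
    {E : β → Set α} (hf : ∀ z ∈ S, f z ∈ T) (hE : ∀ w ∈ T, ∀ z, z ∈ E w ↔ z ∈ S ∧ f z = w) :
    #S = ∑ w ∈ T, (E w).ncard := by
  classical
  rw [card_eq_sum_card_fiberwise hf]
  refine sum_congr rfl fun w hw => ?_
  rw [← Set.ncard_coe_finset]
  congr 1
  ext z
  simp [hE w hw z]

theorem sum_ncard_Bext (u : ℕ → A) (n : ℕ) :
    ∑ w ∈ factors u n, (Bext u w).ncard = #(factors u (n + 2)) := by
  refine (card_eq_sum_ncard_fiber (f := fun z => z.tail.dropLast) (fun z hz => ?_)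
    fun w hw z => ⟨?_, ?_⟩).symm
  · rw [mem_factors] at hz
    obtain ⟨a, w, b, rfl, hw⟩ := exists_eq_cons_append_singleton hz.2
    simpa [hw] using mem_language_of_infix hz.1 ⟨[a], [b], by simp⟩
  · rintro ⟨h, a, b, rfl⟩
    simp [h, (mem_factors.mp hw).2]
  · rintro ⟨hz, rfl⟩
    rw [mem_factors] at hz
    obtain ⟨a, w, b, rfl, -⟩ := exists_eq_cons_append_singleton hz.2
    exact ⟨hz.1, a, b, by simp⟩

theorem sum_ncard_Lext (u : ℕ → A) (n : ℕ) :
    ∑ w ∈ factors u n, (Lext u w).ncard = #(factors u (n + 1)) := by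
  refine (card_eq_sum_ncard_fiber (f := List.tail) (fun z hz => ?_) fun w hw z => ⟨?_, ?_⟩).symm
  · rw [mem_factors] at hz
    simpa [hz.2] using mem_language_of_infix hz.1 (List.tail_suffix z).isInfix
  · rintro ⟨h, a, rfl⟩
    simp [h, (mem_factors.mp hw).2]
  · rintro ⟨hz, rfl⟩
    rw [mem_factors] at hz
    obtain ⟨a, w, rfl⟩ := List.exists_cons_of_length_eq_add_one hz.2
    exact ⟨hz.1, a, by simp⟩

theorem sum_ncard_Rext (u : ℕ → A) (n : ℕ) :
    ∑ w ∈ factors u n, (Rext u w).ncard = #(factors u (n + 1)) := by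
  refine (card_eq_sum_ncard_fiber (f := List.dropLast) (fun z hz => ?_)
    fun w hw z => ⟨?_, ?_⟩).symm
  · rw [mem_factors] at hz
    simpa [hz.2] using mem_language_of_infix hz.1 (List.dropLast_prefix z).isInfix
  · rintro ⟨h, b, rfl⟩
    simp [h, (mem_factors.mp hw).2]
  · rintro ⟨hz, rfl⟩
    rw [mem_factors] at hz
    obtain ⟨w, b, rfl⟩ := (List.eq_nil_or_concat' z).resolve_left (by rintro rfl; simp at hz)
    exact ⟨hz.1, b, by simp⟩

theorem sum_ncard_Pext (u : ℕ → A) (n : ℕ) :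
    ∑ w ∈ palFactors u n, (Pext u w).ncard = #(palFactors u (n + 2)) := by
  refine (card_eq_sum_ncard_fiber (f := fun z => z.tail.dropLast) (fun z hz => ?_)
    fun w hw z => ⟨?_, ?_⟩).symm
  · rw [mem_palFactors] at hz
    obtain ⟨a, w, b, rfl, hw⟩ := exists_eq_cons_append_singleton hz.1.2
    simpa [hw, (palindrome_cons_append_singleton_iff.mp hz.2).2] using
      mem_language_of_infix hz.1.1 ⟨[a], [b], by simp⟩
  · rintro ⟨h, a, rfl⟩
    rw [mem_palFactors] at hw
    simp [h, hw.1.2, palindrome_cons_append_singleton_iff, hw.2]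
  · rintro ⟨hz, rfl⟩
    rw [mem_palFactors] at hz
    obtain ⟨a, w, b, rfl, -⟩ := exists_eq_cons_append_singleton hz.1.2
    obtain ⟨rfl, -⟩ := palindrome_cons_append_singleton_iff.mp hz.2
    exact ⟨hz.1.1, a, by simp⟩

theorem sum_bilateralOrder (u : ℕ → A) (n : ℕ) :
    ∑ w ∈ factors u n, bilateralOrder u w =
      (#(factors u (n + 2)) : ℤ) - 2 * #(factors u (n + 1)) + #(factors u n) := by
  simp only [bilateralOrder, sum_add_distrib, sum_sub_distrib, ← Nat.cast_sum, sum_ncard_Bext,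
    sum_ncard_Lext, sum_ncard_Rext, sum_const, nsmul_one]
  ring

theorem sum_bilateralOrder_of_hasRichOrder (h : ∀ w ∈ language u, HasRichOrder u w) (n : ℕ) :
    ∑ w ∈ factors u n, bilateralOrder u w =
      (#(palFactors u (n + 2)) : ℤ) - #(palFactors u n) := by
  have : ∑ w ∈ factors u n, bilateralOrder u w =
      ∑ w ∈ palFactors u n, (((Pext u w).ncard : ℤ) - 1) := by
    rw [palFactors, sum_filter]
    refine sum_congr rfl fun w hw => ?_
    have hw' := h w (mem_factors.mp hw).1
    split_ifs with hpal
    · exact hw'.2 hpal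
    · exact hw'.1 hpal
  rw [this, sum_sub_distrib, ← Nat.cast_sum, sum_ncard_Pext, sum_const, nsmul_one]

theorem factors_zero (u : ℕ → A) : factors u 0 = {[]} := by
  ext w
  simp only [mem_factors, List.length_eq_zero_iff, mem_singleton, and_iff_right_iff_imp]
  rintro rfl
  exact block_mem_language u 0 0

theorem palFactors_zero (u : ℕ → A) : palFactors u 0 = factors u 0 := by
  classical
  refine filter_true_of_mem fun w hw => ?_
  rw [factors_zero, mem_singleton] at hw
  exact hw ▸ List.Palindrome.nil

theorem palFactors_one (u : ℕ → A) : palFactors u 1 = factors u 1 := by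
  classical
  refine filter_true_of_mem fun w hw => ?_
  obtain ⟨a, rfl⟩ := List.length_eq_one_iff.mp (mem_factors.mp hw).2
  exact List.Palindrome.singleton a

theorem card_palFactors_add_card_palFactors_succ (h : ∀ w ∈ language u, HasRichOrder u w)
    (n : ℕ) :
    (#(palFactors u n) : ℤ) + #(palFactors u (n + 1)) =
      #(factors u (n + 1)) - #(factors u n) + 2 := by
  induction n with
  | zero =>
    rw [zero_add, palFactors_one, palFactors_zero, factors_zero, card_singleton]
    push_cast
    ring
  | succ n ih =>
    have := (sum_bilateralOrder_of_hasRichOrder h n).symm.trans (sum_bilateralOrder u n)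
    rw [add_assoc]
    linarith

end Counting

/-! ### Walks in trees -/

section Walks

variable {V E : Type*} {x : ℕ → V}

theorem eq_of_first_return_of_isAcyclic {G : SimpleGraph V} (hG : G.IsAcyclic) {m : ℕ}
    (hstep : ∀ i, x i ≠ x (i + 1) → G.Adj (x i) (x (i + 1))) (hm : x (m + 1) = x 0)
    (hint : ∀ i < m, x (i + 1) ≠ x 0) : x m = x 1 := by
  cases m with
  | zero => exact hm.symm
  | succ m =>
    by_contra hne
    have hadj : G.Adj (x 0) (x 1) := hstep 0 (hint 0 (by omega)).symm
    have hbridge := SimpleGraph.isBridge_iff.mp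
      (SimpleGraph.isAcyclic_iff_forall_adj_isBridge.mp hG hadj)
    have hreach : ∀ i ≤ m, (G.deleteEdges {s(x 0, x 1)}).Reachable (x 1) (x (i + 1)) := by
      intro i hi
      induction i with
      | zero => exact SimpleGraph.Reachable.refl _
      | succ i ih =>
        refine (ih (by omega)).trans ?_
        by_cases he : x (i + 1) = x (i + 1 + 1)
        · rw [he]
        · refine SimpleGraph.Adj.reachable (SimpleGraph.deleteEdges_adj.mpr ⟨hstep _ he, ?_⟩)
          have h1 := hint i (by omega)
          have h2 := hint (i + 1) (by omega)
          simp only [Set.mem_singleton_iff, Sym2.eq_iff]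
          tauto
    have hlast := hstep (m + 1) (by rw [hm]; exact hint m (by omega))
    rw [hm] at hlast
    refine hbridge ((hreach m le_rfl).trans
      (SimpleGraph.Adj.reachable (SimpleGraph.deleteEdges_adj.mpr ⟨hlast, ?_⟩))).symm
    have := hint m (by omega)
    simp only [Set.mem_singleton_iff, Sym2.eq_iff]
    tauto

/-- The simple graph on `V` traversed by the walk `x`; steps that stay in place give no edge. -/
def walkGraph (x : ℕ → V) : SimpleGraph V :=
  SimpleGraph.fromRel fun v w => ∃ i, v = x i ∧ w = x (i + 1)

theorem walkGraph_adj {i : ℕ} (h : x i ≠ x (i + 1)) : (walkGraph x).Adj (x i) (x (i + 1)) :=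
  (SimpleGraph.fromRel_adj _ _ _).mpr ⟨h, Or.inl ⟨i, rfl, rfl⟩⟩

theorem edgeSet_walkGraph (x : ℕ → V) :
    (walkGraph x).edgeSet = (fun i => s(x i, x (i + 1))) '' {i | x i ≠ x (i + 1)} := by
  ext e
  constructor
  · induction e using Sym2.ind with
    | h v w =>
      intro he
      rw [SimpleGraph.mem_edgeSet, walkGraph, SimpleGraph.fromRel_adj] at he
      obtain ⟨hne, ⟨i, rfl, rfl⟩ | ⟨i, rfl, rfl⟩⟩ := he
      · exact ⟨i, hne, rfl⟩
      · exact ⟨i, hne.symm, Sym2.eq_swap⟩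
  · rintro ⟨i, hi, rfl⟩
    exact walkGraph_adj hi

theorem connected_walkGraph (hx : Function.Surjective x) : (walkGraph x).Connected := by
  rw [SimpleGraph.connected_iff_exists_forall_reachable]
  refine ⟨x 0, fun v => ?_⟩
  obtain ⟨j, rfl⟩ := hx v
  induction j with
  | zero => exact SimpleGraph.Reachable.refl _
  | succ j ih =>
    by_cases hne : x j = x (j + 1)
    · rwa [← hne]
    · exact ih.trans (walkGraph_adj hne).reachable

theorem isTree_walkGraph_and_label_eq [Finite V] (hx : Function.Surjective x) {c : ℕ → E}
    (hc : Function.FactorsThrough (fun i => s(x i, x (i + 1))) c)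
    (hfin : (c '' {i | x i ≠ x (i + 1)}).Finite)
    (hcard : (c '' {i | x i ≠ x (i + 1)}).ncard + 1 ≤ Nat.card V) :
    (walkGraph x).IsTree ∧ ∀ i j, x i ≠ x (i + 1) → x j ≠ x (j + 1) →
      s(x i, x (i + 1)) = s(x j, x (j + 1)) → c i = c j := by
  set L := c '' {i | x i ≠ x (i + 1)}
  let ends : E → Sym2 V := Function.extend c (fun i => s(x i, x (i + 1))) fun _ => s(x 0, x 0)
  have hends : ∀ i, ends (c i) = s(x i, x (i + 1)) := fun i => hc.extend_apply _ i
  have hedges : (walkGraph x).edgeSet = ends '' L := by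
    rw [edgeSet_walkGraph, Set.image_image]
    exact Set.image_congr fun i _ => (hends i).symm
  have hconn := connected_walkGraph hx
  have hlower := hconn.card_vert_le_card_edgeSet_add_one
  have hupper := Set.ncard_image_le (f := ends) hfin
  rw [hedges, Nat.card_coe_set_eq] at hlower
  have hinj : Set.InjOn ends L := Set.injOn_of_ncard_image_eq (by omega) hfin
  refine ⟨SimpleGraph.isTree_iff_connected_and_card.mpr ⟨hconn, ?_⟩, fun i j hi hj hij => ?_⟩
  · rw [hedges, Nat.card_coe_set_eq]
    omega
  · exact hinj ⟨i, hi, rfl⟩ ⟨j, hj, rfl⟩ (by rw [hends, hends, hij])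

theorem label_eq_of_first_return [Finite V] (hx : Function.Surjective x) {c : ℕ → E}
    (hc : Function.FactorsThrough (fun i => s(x i, x (i + 1))) c)
    (hfin : (c '' {i | x i ≠ x (i + 1)}).Finite)
    (hcard : (c '' {i | x i ≠ x (i + 1)}).ncard + 1 ≤ Nat.card V) {j m : ℕ}
    (hm : x (j + m + 1) = x j) (hint : ∀ i < m, x (j + i + 1) ≠ x j) : c j = c (j + m) := by
  obtain ⟨htree, hlabel⟩ := isTree_walkGraph_and_label_eq hx hc hfin hcard
  rcases m.eq_zero_or_pos with rfl | hpos
  · rfl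
  have hback : x (j + m) = x (j + 1) :=
    eq_of_first_return_of_isAcyclic (x := fun i => x (j + i)) htree.isAcyclic
      (fun i hi => walkGraph_adj hi) hm hint
  have hne : x j ≠ x (j + 1) := (hint 0 hpos).symm
  exact hlabel _ _ hne (by rw [hback, hm]; exact hne.symm) (by rw [hback, hm, Sym2.eq_swap])

end Walks

/-! ### Factors up to reversal -/

section ReversalClasses

open Finset

theorem two_mul_card_image_of_involutive {α : Type*} [DecidableEq α] {f : α → α}
    (hf : Function.Involutive f) {S : Finset α} (hS : ∀ x ∈ S, f x ∈ S) :
    2 * #(S.image fun x => s(x, f x)) = #S + #{x ∈ S | f x = x} := by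
  have hfix : #{x ∈ S | f x = x} = ∑ c ∈ S.image fun x => s(x, f x),
      #{x ∈ {x ∈ S | f x = x} | s(x, f x) = c} :=
    card_eq_sum_card_fiberwise fun x hx => mem_image_of_mem _ (mem_filter.mp hx).1
  rw [card_eq_sum_card_image (fun x => s(x, f x)) S, hfix, ← sum_add_distrib, mul_comm,
    ← smul_eq_mul, ← sum_const]
  refine sum_congr rfl fun c hc => ?_
  obtain ⟨x, hx, rfl⟩ := mem_image.mp hc
  have hclass : ∀ y, s(y, f y) = s(x, f x) ↔ y = x ∨ y = f x := by
    intro y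
    rw [Sym2.eq_iff]
    grind [hf x]
  have hfiber : {y ∈ S | s(y, f y) = s(x, f x)} = {x, f x} := by
    ext y
    simp only [mem_filter, hclass, mem_insert, mem_singleton]
    grind
  rw [hfiber]
  by_cases hfx : f x = x
  · have : {y ∈ {y ∈ S | f y = y} | s(y, f y) = s(x, f x)} = {x} := by
      ext y
      simp only [mem_filter, hclass, mem_singleton]
      grind
    rw [this, hfx, pair_eq_singleton, card_singleton]
  · have : {y ∈ {y ∈ S | f y = y} | s(y, f y) = s(x, f x)} = ∅ := by
      ext y
      simp only [mem_filter, hclass, notMem_empty, iff_false]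
      grind [hf x]
    rw [this, card_pair (Ne.symm hfx), card_empty]

variable {A : Type*}

/-- The class of a word up to reversal. -/
def revClass (w : List A) : Sym2 (List A) :=
  s(w, w.reverse)

theorem revClass_eq_iff {v w : List A} : revClass v = revClass w ↔ v = w ∨ v = w.reverse := by
  simp only [revClass, Sym2.eq_iff]
  constructor
  · rintro (h | h)
    · exact Or.inl h.1
    · exact Or.inr h.1
  · rintro (rfl | rfl) <;> simp

theorem revClass_reverse (w : List A) : revClass w.reverse = revClass w :=
  revClass_eq_iff.mpr (Or.inr rfl)

theorem sym2_revClass_dropLast_tail_congr {v w : List A} (h : revClass v = revClass w) :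
    s(revClass v.dropLast, revClass v.tail) = s(revClass w.dropLast, revClass w.tail) := by
  rcases revClass_eq_iff.mp h with rfl | rfl
  · rfl
  · rw [List.dropLast_reverse, List.tail_reverse, revClass_reverse, revClass_reverse,
      Sym2.eq_swap]

theorem dropLast_block (u : ℕ → A) (j n : ℕ) : (block u j (n + 1)).dropLast = block u j n := by
  rw [block_succ, List.dropLast_concat]

theorem tail_block (u : ℕ → A) (j n : ℕ) : (block u j (n + 1)).tail = block u (j + 1) n := by
  rw [block_succ', List.tail_cons]

theorem revClass_block_eq_succ_of_palindrome {u : ℕ → A} {j n : ℕ}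
    (h : (block u j (n + 1)).Palindrome) :
    revClass (block u j n) = revClass (block u (j + 1) n) := by
  rw [← dropLast_block, ← tail_block, ← revClass_reverse, ← List.tail_reverse, h.reverse_eq]

variable [Finite A] {u : ℕ → A}

open Classical in
/-- The classes up to reversal of the factors of length `n`. -/
noncomputable def revClasses (u : ℕ → A) (n : ℕ) : Finset (Sym2 (List A)) :=
  (factors u n).image revClass

open Classical in
/-- The classes up to reversal of the non-palindromic factors of length `n`. -/
noncomputable def nonpalRevClasses (u : ℕ → A) (n : ℕ) : Finset (Sym2 (List A)) :=
  {w ∈ factors u n | ¬ w.Palindrome}.image revClass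

theorem coe_revClasses (u : ℕ → A) (n : ℕ) :
    (revClasses u n : Set (Sym2 (List A))) = Set.range fun j => revClass (block u j n) := by
  classical
  ext c
  simp only [revClasses, coe_image, Set.mem_image, mem_coe, Set.mem_range]
  constructor
  · rintro ⟨w, hw, rfl⟩
    obtain ⟨⟨j, hj⟩, rfl⟩ := mem_factors.mp hw
    exact ⟨j, by rw [← hj]⟩
  · rintro ⟨j, rfl⟩
    exact ⟨_, block_mem_factors u j n, rfl⟩

namespace IsClosedUnderReversal

theorem two_mul_card_revClasses (hu : IsClosedUnderReversal u) (n : ℕ) :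
    2 * #(revClasses u n) = #(factors u n) + #(palFactors u n) := by
  classical
  simp only [palFactors, List.Palindrome.iff_reverse_eq]
  refine two_mul_card_image_of_involutive List.reverse_involutive fun w hw => ?_
  rw [mem_factors] at hw ⊢
  exact ⟨hu w hw.1, by rw [List.length_reverse, hw.2]⟩

theorem two_mul_card_nonpalRevClasses (hu : IsClosedUnderReversal u) (n : ℕ) :
    2 * #(nonpalRevClasses u n) + #(palFactors u n) = #(factors u n) := by
  classical
  have hnofix : {w ∈ {w ∈ factors u n | ¬ w.Palindrome} | w.reverse = w} = ∅ :=
    filter_false_of_mem fun w hw hrev => (mem_filter.mp hw).2 (.of_reverse_eq hrev)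
  have := two_mul_card_image_of_involutive List.reverse_involutive
    (S := {w ∈ factors u n | ¬ w.Palindrome}) fun w hw => by
      simp only [mem_filter, mem_factors, List.Palindrome.iff_reverse_eq, List.length_reverse,
        List.reverse_reverse] at hw ⊢
      exact ⟨⟨hu w hw.1.1, hw.1.2⟩, fun h => hw.2 h.symm⟩
  rw [hnofix, card_empty, add_zero] at this
  rw [← card_filter_add_card_filter_not (s := factors u n) List.Palindrome, ← this, add_comm]
  rfl

theorem card_nonpalRevClasses_succ_add_one (hu : IsClosedUnderReversal u)
    (h : ∀ w ∈ language u, HasRichOrder u w) (n : ℕ) :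
    #(nonpalRevClasses u (n + 1)) + 1 = #(revClasses u n) := by
  have h1 := card_palFactors_add_card_palFactors_succ h n
  have h2 := hu.two_mul_card_revClasses n
  have h3 := hu.two_mul_card_nonpalRevClasses (n + 1)
  omega

theorem revClass_block_eq_of_first_return (hu : IsClosedUnderReversal u)
    (h : ∀ w ∈ language u, HasRichOrder u w) {n j m : ℕ}
    (hm : revClass (block u (j + m + 1) n) = revClass (block u j n))
    (hint : ∀ i < m, revClass (block u (j + i + 1) n) ≠ revClass (block u j n)) :
    revClass (block u j (n + 1)) = revClass (block u (j + m) (n + 1)) := by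
  classical
  let x : ℕ → revClasses u n := fun i =>
    ⟨revClass (block u i n), mem_image_of_mem _ (block_mem_factors u i n)⟩
  let c : ℕ → Sym2 (List A) := fun i => revClass (block u i (n + 1))
  have hlabels : c '' {i | x i ≠ x (i + 1)} ⊆ nonpalRevClasses u (n + 1) := by
    rintro _ ⟨i, hi, rfl⟩
    refine mem_image_of_mem _ (mem_filter.mpr ⟨block_mem_factors u i (n + 1), fun hp => hi ?_⟩)
    exact Subtype.ext (revClass_block_eq_succ_of_palindrome hp)
  have hle := Set.ncard_le_ncard hlabels (finite_toSet _)
  rw [Set.ncard_coe_finset] at hle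
  refine label_eq_of_first_return (x := x) (c := c) ?_ ?_ ((finite_toSet _).subset hlabels) ?_
    (Subtype.ext hm) fun i hi heq => hint i hi (congrArg Subtype.val heq)
  · rintro ⟨w, hw⟩
    obtain ⟨j, rfl⟩ := (coe_revClasses u n).subset hw
    exact ⟨j, rfl⟩
  · intro i k hik
    have := sym2_revClass_dropLast_tail_congr hik
    simp only [dropLast_block, tail_block] at this
    exact Sym2.map.injective Subtype.val_injective this
  · rw [Nat.card_eq_fintype_card, Fintype.card_coe, ← hu.card_nonpalRevClasses_succ_add_one h]
    omega

end IsClosedUnderReversal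

end ReversalClasses

section PalindromicReturns

variable {A : Type*}

theorem exists_mismatch_of_not_palindrome {z : List A} (h : ¬ z.Palindrome) :
    ∃ t a b y y', z = t ++ a :: y ∧ z = y' ++ b :: t.reverse ∧ a ≠ b := by
  induction z using List.bidirectionalRec with
  | nil => exact absurd .nil h
  | singleton a => exact absurd (.singleton a) h
  | cons_append a w b ih =>
    by_cases hab : a = b
    · subst hab
      obtain ⟨t, c, e, y, y', hy, hy', hce⟩ :=
        ih fun hw => h (palindrome_cons_append_singleton_iff.mpr ⟨rfl, hw⟩)
      exact ⟨a :: t, c, e, y ++ [a], a :: y', by simp [hy], by simp [hy'], hce⟩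
    · exact ⟨[], a, b, w ++ [b], a :: w, rfl, by simp, hab⟩

theorem prefix_of_mismatch {v z t y y' : List A} {a b : A} (hv : v.Palindrome) (hpre : v <+: z)
    (hsuf : v <:+ z) (hz : z = t ++ a :: y) (hz' : z = y' ++ b :: t.reverse) (hab : a ≠ b) :
    v <+: t := by
  rcases le_or_gt v.length t.length with hle | hlt
  · exact List.prefix_of_prefix_length_le hpre ⟨_, hz.symm⟩ hle
  · have ha : t ++ [a] <+: v :=
      List.prefix_of_prefix_length_le ⟨y, by simp [hz]⟩ hpre (by simpa using hlt)
    have hb : b :: t.reverse <:+ v :=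
      List.suffix_of_suffix_length_le ⟨y', hz'.symm⟩ hsuf (by simpa using hlt)
    have hb' : t ++ [b] <+: v := by simpa [hv.reverse_eq] using List.reverse_prefix.mpr hb
    have := (List.prefix_of_prefix_length_le ha hb' (by simp)).eq_of_length (by simp)
    exact absurd (by simpa using this) hab

theorem eq_of_revClass_append_singleton_eq {t : List A} {a b : A}
    (h : revClass (t ++ [a]) = revClass (b :: t.reverse)) : a = b := by
  rcases revClass_eq_iff.mp h with h | h
  · cases t with
    | nil => simpa using h
    | cons c t =>
      obtain ⟨rfl, ht⟩ := List.cons.inj h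
      exact (by simpa using congrArg List.reverse ht : a = c ∧ t.reverse = t).1
  · simpa using h

variable [Finite A] {u : ℕ → A}

namespace IsClosedUnderReversal

theorem revClass_eq_of_mismatch (hu : IsClosedUnderReversal u)
    (h : ∀ w ∈ language u, HasRichOrder u w) {z t y y' : List A} {a b : A} (hz : z ∈ language u)
    (hy : z = t ++ a :: y) (hy' : z = y' ++ b :: t.reverse)
    (hint : ∀ r s r', z = r ++ s ++ r' → revClass s = revClass t → r = [] ∨ r' = []) :
    revClass (t ++ [a]) = revClass (b :: t.reverse) := by
  obtain ⟨j, hj⟩ := hz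
  have hlen : z.length = t.length + 1 + y.length := by
    rw [hy]
    simp only [List.length_append, List.length_cons]
    omega
  have hlen' : y'.length = y.length := by
    have := congrArg List.length hy'
    simp only [List.length_append, List.length_cons, List.length_reverse] at this
    omega
  rw [hlen] at hj
  have hfirst : block u j (t.length + 1) = t ++ [a] := by
    rw [block_add, hy, List.append_cons] at hj
    exact (List.append_inj hj (by simp)).1.symm
  have hlast : block u (j + y.length) (t.length + 1) = b :: t.reverse := by
    rw [add_comm, block_add, hy'] at hj
    exact (List.append_inj hj (by simpa using hlen')).2.symm
  have ht : block u j t.length = t := by rw [← dropLast_block, hfirst, List.dropLast_concat]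
  rw [← hfirst, ← hlast]
  refine hu.revClass_block_eq_of_first_return h ?_ fun i hi he => ?_
  · rw [← tail_block, hlast, ht, List.tail_cons, revClass_reverse]
  · rw [ht] at he
    obtain ⟨k, hk⟩ := Nat.exists_eq_add_of_lt hi
    have hz : z = block u j (i + 1) ++ block u (j + i + 1) t.length ++
        block u (j + i + 1 + t.length) (k + 1) := by
      rw [hj, show t.length + 1 + y.length = i + 1 + t.length + (k + 1) by omega, block_add,
        block_add]
      simp only [add_assoc]
    rcases hint _ _ _ hz he with h0 | h0 <;> simpa using congrArg List.length h0

theorem palindrome_of_isCompleteReturn (hu : IsClosedUnderReversal u)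
    (h : ∀ w ∈ language u, HasRichOrder u w) {v z : List A} (hv : v.Palindrome)
    (hz : z ∈ language u) (hret : IsCompleteReturn v z) : z.Palindrome := by
  obtain ⟨-, hpre, hsuf, hocc⟩ := isCompleteReturn_iff.mp hret
  by_contra hnp
  obtain ⟨t, a, b, y, y', hy, hy', hab⟩ := exists_mismatch_of_not_palindrome hnp
  obtain ⟨q, rfl⟩ := prefix_of_mismatch hv hpre hsuf hy hy' hab
  refine hab (eq_of_revClass_append_singleton_eq
    (hu.revClass_eq_of_mismatch h hz hy hy' fun r s r' hr hs => ?_))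
  rcases revClass_eq_iff.mp hs with rfl | rfl
  · refine (hocc r (q ++ r') (by simp [hr])).imp_right fun h0 => ?_
    exact (List.append_eq_nil_iff.mp h0).2
  · refine (hocc (r ++ q.reverse) r' (by simp [hr, hv.reverse_eq])).imp_left fun h0 => ?_
    exact (List.append_eq_nil_iff.mp h0).1

theorem isRich_of_hasRichOrder (hu : IsClosedUnderReversal u)
    (h : ∀ w, IsBispecial u w → HasRichOrder u w) : IsRich u := by
  have hall : ∀ w ∈ language u, HasRichOrder u w := fun w hw =>
    (em (IsBispecial u w)).elim (h w) (hu.hasRichOrder_of_not_isBispecial hw)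
  exact fun w hw => isRichWord_of_palindromic_returns fun v z hv hz hret =>
    hu.palindrome_of_isCompleteReturn hall hv (mem_language_of_infix hw hz) hret

end IsClosedUnderReversal

end PalindromicReturns

/-! ### Stars and double stars -/

section Stars

variable {A A' B : Type*}

/-- A star with centre `k`, seen as a symmetric relation, to which loops are added at the centre or
at one leaf. -/
structure IsLoopedStar (R : SetRel A A) (k : A) : Prop where
  symm : ∀ ⦃i j⦄, (i, j) ∈ R → (j, i) ∈ R
  eq_or_eq : ∀ ⦃i j⦄, (i, j) ∈ R → i = j ∨ i = k ∨ j = k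
  center_mem : ∀ ⦃i⦄, (i, i) ∈ R → i ≠ k → (k, i) ∈ R
  loop_unique : ∀ ⦃i j⦄, (i, i) ∈ R → (j, j) ∈ R → i ≠ k → j ≠ k → i = j

/-- A relation whose bipartite graph consists of two stars with the adjacent centres `k` and
`m`. -/
structure IsDoubleStar (R : SetRel A A') (k : A) (m : A') : Prop where
  center_mem : (k, m) ∈ R
  eq_or_eq : ∀ ⦃i j⦄, (i, j) ∈ R → i = k ∨ j = m

theorem IsDoubleStar.inv {R : SetRel A A'} {k : A} {m : A'} (h : IsDoubleStar R k m) :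
    IsDoubleStar R.inv m k :=
  ⟨h.center_mem, fun _ _ hij => (h.eq_or_eq hij).symm⟩

theorem IsLoopedStar.center_mem_of_ne {R : SetRel A A} {k i j : A} (h : IsLoopedStar R k)
    (hij : (i, j) ∈ R) (hi : i ≠ k) : (k, i) ∈ R := by
  rcases h.eq_or_eq hij with rfl | rfl | rfl
  exacts [h.center_mem hij hi, absurd rfl hi, h.symm hij]

theorem IsLoopedStar.eq_of_ne {R : SetRel A A} {k i j : A} (h : IsLoopedStar R k)
    (hij : (i, j) ∈ R) (hi : i ≠ k) (hj : j ≠ k) : i = j :=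
  (h.eq_or_eq hij).resolve_right (not_or_intro hi hj)

theorem IsLoopedStar.inv_eq {R : SetRel A A} {k : A} (h : IsLoopedStar R k) : R.inv = R :=
  Set.ext fun _ => ⟨fun hij => h.symm hij, fun hij => h.symm hij⟩

theorem IsDoubleStar.relOrder_eq [Finite A] {R : SetRel A A} {k m : A} (h : IsDoubleStar R k m) :
    relOrder R = 0 := by
  have hk : k ∈ R.dom := ⟨m, h.center_mem⟩
  have hR : R = {k} ×ˢ R.cod ∪ (R.dom \ {k}) ×ˢ {m} := by
    ext ⟨i, j⟩
    simp only [Set.mem_union, Set.mem_prod, Set.mem_singleton_iff, Set.mem_sdiff]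
    constructor
    · intro hij
      by_cases hi : i = k
      · exact Or.inl ⟨hi, i, hij⟩
      · exact Or.inr ⟨⟨⟨j, hij⟩, hi⟩, (h.eq_or_eq hij).resolve_left hi⟩
    · rintro (⟨rfl, l, hl⟩ | ⟨⟨⟨l, hl⟩, hi⟩, rfl⟩)
      · rcases h.eq_or_eq hl with rfl | rfl
        exacts [hl, h.center_mem]
      · obtain rfl := (h.eq_or_eq hl).resolve_left hi
        exact hl
  have hdisj : Disjoint ({k} ×ˢ R.cod) ((R.dom \ {k}) ×ˢ {m}) :=
    Set.disjoint_left.mpr fun _ hx hy => hy.1.2 hx.1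
  have hcard : R.ncard = R.cod.ncard + (R.dom \ {k}).ncard := by
    conv_lhs => rw [hR]
    rw [Set.ncard_union_eq hdisj, Set.ncard_prod, Set.ncard_prod, Set.ncard_singleton,
      Set.ncard_singleton, one_mul, mul_one]
  rw [relOrder, hcard, ← Set.ncard_sdiff_singleton_add_one hk]
  push_cast
  ring

theorem IsLoopedStar.relOrder_eq [Finite A] {R : SetRel A A} {k : A} (h : IsLoopedStar R k)
    (hdom : R.dom.Nontrivial) : relOrder R = ({i | (i, i) ∈ R}.ncard : ℤ) - 1 := by
  have hcod : R.cod = R.dom := by rw [← SetRel.dom_inv, h.inv_eq]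
  have hleaf : ∀ i, i ∈ R.dom \ {k} ↔ i ≠ k ∧ (k, i) ∈ R :=
    fun i => ⟨fun ⟨⟨j, hij⟩, hi⟩ => ⟨hi, h.center_mem_of_ne hij hi⟩,
      fun ⟨hi, hki⟩ => ⟨⟨k, h.symm hki⟩, hi⟩⟩
  have hk : k ∈ R.dom := by
    obtain ⟨i, hi, hik⟩ := hdom.exists_ne k
    exact ⟨i, ((hleaf i).mp ⟨hi, hik⟩).2⟩
  have hR : R = {k} ×ˢ (R.dom \ {k}) ∪ (R.dom \ {k}) ×ˢ {k} ∪
      (fun i => (i, i)) '' {i | (i, i) ∈ R} := by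
    ext ⟨i, j⟩
    simp only [Set.mem_union, Set.mem_prod, Set.mem_singleton_iff, hleaf, Set.mem_image,
      Prod.mk.injEq, Set.mem_ofPred_eq]
    constructor
    · intro hij
      by_cases hij' : i = j
      · exact Or.inr ⟨i, hij' ▸ hij, rfl, hij'⟩
      · rcases (h.eq_or_eq hij).resolve_left hij' with rfl | rfl
        · exact Or.inl (Or.inl ⟨rfl, Ne.symm hij', hij⟩)
        · exact Or.inl (Or.inr ⟨⟨hij', h.symm hij⟩, rfl⟩)
    · rintro ((⟨rfl, -, hj⟩ | ⟨⟨-, hi⟩, rfl⟩) | ⟨l, hl, rfl, rfl⟩)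
      exacts [hj, h.symm hi, hl]
  have hdisj : Disjoint ({k} ×ˢ (R.dom \ {k})) ((R.dom \ {k}) ×ˢ {k}) :=
    Set.disjoint_left.mpr fun _ hx hy => hy.1.2 hx.1
  have hdisj' : Disjoint ({k} ×ˢ (R.dom \ {k}) ∪ (R.dom \ {k}) ×ˢ {k})
      ((fun i => (i, i)) '' {i | (i, i) ∈ R}) := by
    refine Set.disjoint_right.mpr ?_
    rintro _ ⟨i, -, rfl⟩ (hi | hi)
    exacts [hi.2.2 hi.1, hi.1.2 hi.2]
  have hcard : R.ncard = (R.dom \ {k}).ncard + (R.dom \ {k}).ncard + {i | (i, i) ∈ R}.ncard := by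
    conv_lhs => rw [hR]
    rw [Set.ncard_union_eq hdisj', Set.ncard_union_eq hdisj, Set.ncard_prod, Set.ncard_prod,
      Set.ncard_singleton, one_mul, mul_one,
      Set.ncard_image_of_injective _ fun i j hij => congrArg Prod.fst hij]
  rw [relOrder, hcod, hcard, ← Set.ncard_sdiff_singleton_add_one hk]
  push_cast
  ring

/-- The relation obtained from `R` by identifying letters as told by `F` on the left and by `G` on
the right, where letters outside the codomains of `F` and `G` are dropped. -/
def contract (F : SetRel B A) (R : SetRel A A') (G : SetRel B A') : SetRel B B :=
  F.comp (R.comp G.inv)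

theorem mem_contract {F : SetRel B A} {R : SetRel A A'} {G : SetRel B A'} {a b : B} :
    (a, b) ∈ contract F R G ↔ ∃ i j, (a, i) ∈ F ∧ (i, j) ∈ R ∧ (b, j) ∈ G := by
  simp only [contract, SetRel.mem_comp, SetRel.mem_inv, exists_and_left]

theorem inv_contract (F : SetRel B A) (R : SetRel A A') (G : SetRel B A') :
    (contract F R G).inv = contract G R.inv F := by
  simp only [contract, SetRel.inv_comp, SetRel.inv_inv, SetRel.comp_assoc]

theorem nontrivial_dom_of_contract {F : SetRel B A} {R : SetRel A A'} {G : SetRel B A'}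
    (hF : Relator.LeftUnique fun a i => (a, i) ∈ F) (h : (contract F R G).dom.Nontrivial) :
    R.dom.Nontrivial := by
  obtain ⟨a, ⟨b, hab⟩, a', ⟨b', hab'⟩, hne⟩ := h
  obtain ⟨i, j, hi, hij, -⟩ := mem_contract.mp hab
  obtain ⟨i', j', hi', hij', -⟩ := mem_contract.mp hab'
  refine ⟨i, ⟨j, hij⟩, i', ⟨j', hij'⟩, ?_⟩
  rintro rfl
  exact hne (hF hi hi')

theorem IsDoubleStar.exists_left_center {F : SetRel B A} {R : SetRel A A'} {G : SetRel B A'}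
    {k : A} {m : A'} (h : IsDoubleStar R k m) (hG : Relator.LeftUnique fun b j => (b, j) ∈ G)
    (hcod : (contract F R G).cod.Nontrivial) : ∃ a, (a, k) ∈ F := by
  by_contra! hk
  have hm : ∀ b ∈ (contract F R G).cod, (b, m) ∈ G := by
    rintro b ⟨a, hab⟩
    obtain ⟨i, j, hi, hij, hj⟩ := mem_contract.mp hab
    rcases h.eq_or_eq hij with rfl | rfl
    exacts [absurd hi (hk a), hj]
  obtain ⟨b, hb, b', hb', hne⟩ := hcod
  exact hne (hG (hm b hb) (hm b' hb'))

theorem IsDoubleStar.exists_isDoubleStar_contract {F : SetRel B A} {R : SetRel A A'}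
    {G : SetRel B A'} {k : A} {m : A'} (h : IsDoubleStar R k m)
    (hF : Relator.LeftUnique fun a i => (a, i) ∈ F)
    (hG : Relator.LeftUnique fun b j => (b, j) ∈ G) (hdom : (contract F R G).dom.Nontrivial)
    (hcod : (contract F R G).cod.Nontrivial) : ∃ a b, IsDoubleStar (contract F R G) a b := by
  obtain ⟨a, ha⟩ := h.exists_left_center hG hcod
  rw [← SetRel.cod_inv, inv_contract] at hdom
  obtain ⟨b, hb⟩ := h.inv.exists_left_center hF hdom
  refine ⟨a, b, mem_contract.mpr ⟨k, m, ha, h.center_mem, hb⟩, fun a' b' hab => ?_⟩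
  obtain ⟨i, j, hi, hij, hj⟩ := mem_contract.mp hab
  rcases h.eq_or_eq hij with rfl | rfl
  exacts [Or.inl (hF hi ha), Or.inr (hG hj hb)]

theorem IsLoopedStar.exists_left_center {F G : SetRel B A} {R : SetRel A A} {k : A}
    (h : IsLoopedStar R k) (hF : Relator.LeftUnique fun a i => (a, i) ∈ F)
    (hdom : (contract F R G).dom.Nontrivial) (hk : k ∉ G.cod) : ∃ a, (a, k) ∈ F := by
  by_contra! hkF
  have hneF : ∀ {a i}, (a, i) ∈ F → i ≠ k := fun ha hi => hkF _ (hi ▸ ha)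
  have hneG : ∀ {b j}, (b, j) ∈ G → j ≠ k := fun hb hj => hk ⟨_, hj ▸ hb⟩
  obtain ⟨a, ⟨b, hab⟩, a', ⟨b', hab'⟩, haa'⟩ := hdom
  obtain ⟨i, j, hi, hij, hj⟩ := mem_contract.mp hab
  obtain ⟨i', j', hi', hij', hj'⟩ := mem_contract.mp hab'
  obtain rfl := h.eq_of_ne hij (hneF hi) (hneG hj)
  obtain rfl := h.eq_of_ne hij' (hneF hi') (hneG hj')
  obtain rfl := h.loop_unique hij hij' (hneF hi) (hneF hi')
  exact haa' (hF hi hi')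

theorem IsLoopedStar.exists_isLoopedStar_contract {F : SetRel B A} {R : SetRel A A} {k : A}
    (h : IsLoopedStar R k) (hF : Relator.LeftUnique fun a i => (a, i) ∈ F)
    (hdom : (contract F R F).dom.Nontrivial) : ∃ a, IsLoopedStar (contract F R F) a := by
  obtain ⟨a₀, ha₀⟩ : k ∈ F.cod := by
    by_contra hk
    exact hk (h.exists_left_center hF hdom hk)
  have hne : ∀ {a i}, (a, i) ∈ F → a ≠ a₀ → i ≠ k := fun ha haa hi => haa (hF (hi ▸ ha) ha₀)
  refine ⟨a₀, fun a b hab => ?_, fun a b hab => ?_, fun a haa ha => ?_,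
    fun a b haa hbb ha hb => ?_⟩
  · obtain ⟨i, j, hi, hij, hj⟩ := mem_contract.mp hab
    exact mem_contract.mpr ⟨j, i, hj, h.symm hij, hi⟩
  · obtain ⟨i, j, hi, hij, hj⟩ := mem_contract.mp hab
    rcases h.eq_or_eq hij with rfl | rfl | rfl
    exacts [Or.inl (hF hi hj), Or.inr (Or.inl (hF hi ha₀)), Or.inr (Or.inr (hF hj ha₀))]
  · obtain ⟨i, j, hi, hij, -⟩ := mem_contract.mp haa
    exact mem_contract.mpr ⟨k, i, ha₀, h.center_mem_of_ne hij (hne hi ha), hi⟩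
  · obtain ⟨i, j, hi, hij, hj⟩ := mem_contract.mp haa
    obtain ⟨i', j', hi', hij', hj'⟩ := mem_contract.mp hbb
    obtain rfl := h.eq_of_ne hij (hne hi ha) (hne hj ha)
    obtain rfl := h.eq_of_ne hij' (hne hi' hb) (hne hj' hb)
    obtain rfl := h.loop_unique hij hij' (hne hi ha) (hne hi' hb)
    exact hF hi hi'

theorem IsLoopedStar.exists_isDoubleStar_contract_of_notMem_cod {F G : SetRel B A}
    {R : SetRel A A} {k : A} (h : IsLoopedStar R k)
    (hF : Relator.LeftUnique fun a i => (a, i) ∈ F)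
    (hG : Relator.LeftUnique fun b j => (b, j) ∈ G) (hdom : (contract F R G).dom.Nontrivial)
    (hk : k ∉ G.cod) : ∃ a b, IsDoubleStar (contract F R G) a b := by
  have hne : ∀ {b j}, (b, j) ∈ G → j ≠ k := fun hb hj => hk ⟨_, hj ▸ hb⟩
  obtain ⟨a₀, ha₀⟩ := h.exists_left_center hF hdom hk
  obtain ⟨a, ⟨b, hab⟩, haa₀⟩ := hdom.exists_ne a₀
  obtain ⟨l, l', hl, hll, hbl⟩ := mem_contract.mp hab
  have hlk : l ≠ k := fun hlk => haa₀ (hF (hlk ▸ hl) ha₀)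
  obtain rfl := h.eq_of_ne hll hlk (hne hbl)
  refine ⟨a₀, b, mem_contract.mpr ⟨k, l, ha₀, h.center_mem hll hlk, hbl⟩, fun a' b' hab' => ?_⟩
  obtain ⟨i, j, hi, hij, hj⟩ := mem_contract.mp hab'
  by_cases hik : i = k
  · exact Or.inl (hF (hik ▸ hi) ha₀)
  · obtain rfl := h.eq_of_ne hij hik (hne hj)
    obtain rfl := h.loop_unique hij hll hik hlk
    exact Or.inr (hG hj hbl)

theorem IsLoopedStar.exists_isDoubleStar_contract_of_nested {F G : SetRel B A}
    {R : SetRel A A} {k : A} (h : IsLoopedStar R k)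
    (hF : Relator.LeftUnique fun a i => (a, i) ∈ F)
    (hG : Relator.LeftUnique fun b j => (b, j) ∈ G) (hdom : (contract F R G).dom.Nontrivial)
    (hcod : (contract F R G).cod.Nontrivial)
    (hFG : ∀ ⦃a i j⦄, i ∈ G.cod → j ∈ G.cod → (a, i) ∈ F → (a, j) ∈ F) :
    ∃ a b, IsDoubleStar (contract F R G) a b := by
  by_cases hk : k ∈ G.cod
  swap
  · exact h.exists_isDoubleStar_contract_of_notMem_cod hF hG hdom hk
  obtain ⟨b₀, hb₀⟩ := hk
  have hcenter : ∀ {a b i j}, (i, j) ∈ R → j ≠ k → (a, i) ∈ F → (b, j) ∈ G → (a, k) ∈ F := by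
    intro a b i j hij hjk hi hj
    rcases h.eq_or_eq hij with rfl | rfl | hjk'
    exacts [hFG ⟨b, hj⟩ ⟨b₀, hb₀⟩ hi, hi, absurd hjk' hjk]
  obtain ⟨b, ⟨a, hab⟩, hb⟩ := hcod.exists_ne b₀
  obtain ⟨i, j, hi, hij, hj⟩ := mem_contract.mp hab
  have hjk : j ≠ k := fun hjk => hb (hG (hjk ▸ hj) hb₀)
  have ha := hcenter hij hjk hi hj
  refine ⟨a, b₀, mem_contract.mpr ⟨j, k, hFG ⟨b₀, hb₀⟩ ⟨b, hj⟩ ha,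
    h.symm (h.center_mem_of_ne (h.symm hij) hjk), hb₀⟩, fun a' b' hab' => ?_⟩
  obtain ⟨i', j', hi', hij', hj'⟩ := mem_contract.mp hab'
  by_cases hjk' : j' = k
  · exact Or.inr (hG (hjk' ▸ hj') hb₀)
  · exact Or.inl (hF (hcenter hij' hjk' hi' hj') ha)

end Stars

/-! ### Images under morphisms of class `P_ret` -/

section Images

variable {A B : Type*}

@[simp]
theorem onWord_nil (η : A → List B) : onWord η [] = [] :=
  rfl

theorem onWord_append (η : A → List B) (x y : List A) :
    onWord η (x ++ y) = onWord η x ++ onWord η y :=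
  List.flatMap_append

theorem onWord_cons (η : A → List B) (i : A) (x : List A) :
    onWord η (i :: x) = η i ++ onWord η x :=
  List.flatMap_cons

theorem onWord_singleton (η : A → List B) (i : A) : onWord η [i] = η i :=
  List.flatMap_singleton _ _

theorem onWord_infix (η : A → List B) {x y : List A} (h : x <:+: y) :
    onWord η x <:+: onWord η y := by
  obtain ⟨s, t, rfl⟩ := h
  exact ⟨onWord η s, onWord η t, by simp only [onWord_append]⟩

theorem block_onSeq_zero {η : A → List B} (h : ∀ i, η i ≠ []) (u : ℕ → A) (k : ℕ) :
    block (onSeq η h u) 0 (onWord η (block u 0 k)).length = onWord η (block u 0 k) := by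
  refine List.ext_getElem (length_block _ _ _) fun n _ hn => ?_
  simp only [block, List.getElem_map, List.getElem_range, zero_add, onSeq]
  have hprefix : ∀ {m l}, m ≤ l → block u 0 m <+: block u 0 l := by
    intro m l hml
    obtain ⟨r, rfl⟩ := Nat.exists_eq_add_of_le hml
    exact ⟨_, (block_add u 0 m r).symm⟩
  rcases le_total (n + 1) k with hk | hk
  · simpa [block] using (onWord_prefix η (hprefix hk)).getElem (lt_length_onWord_block η h u n)
  · simpa [block] using ((onWord_prefix η (hprefix hk)).getElem hn).symm

/-- The words `s` for which `s ++ p` contains `p` as a suffix only: what precedes the first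
occurrence of `p` in a word. -/
def IsLeadIn (p s : List B) : Prop :=
  ∀ r r', s ++ p = r ++ p ++ r' → r' = []

theorem exists_isLeadIn {p w : List B} (h : p <:+: w) :
    ∃ s z, IsLeadIn p s ∧ w = s ++ p ++ z := by
  obtain ⟨s, z, h⟩ := h
  induction hn : s.length using Nat.strong_induction_on generalizing s z with
  | _ n ih =>
    by_cases hs : IsLeadIn p s
    · exact ⟨s, z, hs, h.symm⟩
    · simp only [IsLeadIn, not_forall] at hs
      obtain ⟨r, r', hr, hne⟩ := hs
      have hlen := congrArg List.length hr
      have := List.length_pos_iff.mpr hne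
      simp only [List.length_append] at hlen
      exact ih r.length (by omega) r (r' ++ z) (by rw [← h, hr]; simp) rfl

theorem IsLeadIn.eq {p s s' z z' : List B} (hs : IsLeadIn p s) (hs' : IsLeadIn p s')
    (h : s ++ p ++ z = s' ++ p ++ z') : s = s' := by
  wlog hle : s.length ≤ s'.length generalizing s s' z z'
  · exact (this hs' hs h.symm (le_of_not_ge hle)).symm
  obtain ⟨r, hr⟩ : s ++ p <+: s' ++ p :=
    List.prefix_of_prefix_length_le ⟨z, h⟩ ⟨z', rfl⟩ (by simpa using hle)
  obtain rfl := hs' s r hr.symm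
  exact List.append_cancel_right (by rwa [List.append_nil] at hr)

/-- The word `s η(x) p tᴿ`. If `η` is of class `P_ret` with common palindrome `p`, every factor of
the image sequence containing `p` has this form, with `s` and `t` preceding the first occurrence
of `p` in the factor and in its reversal. -/
def framedImage (η : A → List B) (p s : List B) (x : List A) (t : List B) : List B :=
  s ++ onWord η x ++ p ++ t.reverse

/-- The pairs `(a, i)` for which `a s` is a suffix of `η(i)`. -/
def precedes (η : A → List B) (s : List B) : SetRel B A :=
  {q | q.1 :: s <:+ η q.2}

theorem leftUnique_precedes (η : A → List B) (s : List B) :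
    Relator.LeftUnique fun a i => (a, i) ∈ precedes η s := by
  intro a i b ha hb
  have := (List.suffix_of_suffix_length_le ha hb (by simp)).eq_of_length (by simp)
  exact (List.cons.inj this).1

namespace IsClassPret

variable {η : A → List B} {p : List B}

theorem prefix_image (hη : IsClassPret η p) (i : A) : p <+: η i := by
  obtain ⟨q, -, hq⟩ := hη.eq_append i
  exact ⟨q, hq.symm⟩

theorem prefix_onWord_append (hη : IsClassPret η p) (x : List A) : p <+: onWord η x ++ p := by
  cases x with
  | nil => exact List.prefix_rfl
  | cons i x =>
    rw [onWord_cons, List.append_assoc]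
    exact (hη.prefix_image i).trans (List.prefix_append _ _)

theorem reverse_image_append (hη : IsClassPret η p) (i : A) : (η i ++ p).reverse = η i ++ p := by
  obtain ⟨q, hq, h⟩ := hη.eq_append i
  simp [h, hq.reverse_eq, hη.palindrome.reverse_eq]

theorem reverse_onWord_append (hη : IsClassPret η p) (x : List A) :
    (onWord η x ++ p).reverse = onWord η x.reverse ++ p := by
  induction x with
  | nil => simpa using hη.palindrome.reverse_eq
  | cons i x ih =>
    have h := hη.reverse_image_append i
    rw [List.reverse_append, hη.palindrome.reverse_eq] at h
    rw [onWord_cons, List.append_assoc, List.reverse_append, ih, List.reverse_cons, onWord_append,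
      onWord_singleton, List.append_assoc, h, List.append_assoc]

theorem exists_onWord_eq_of_append_eq (hη : IsClassPret η p) {y : List A} {s t : List B}
    (h : onWord η y ++ p = s ++ p ++ t) :
    ∃ y₁ y₂, y = y₁ ++ y₂ ∧ s = onWord η y₁ ∧ onWord η y₂ ++ p = p ++ t := by
  induction y generalizing s with
  | nil =>
    have hlen := congrArg List.length h
    simp only [onWord_nil, List.length_append, List.length_nil] at hlen
    obtain rfl : s = [] := List.length_eq_zero_iff.mp (by omega)
    exact ⟨[], [], rfl, rfl, h⟩
  | cons i y ih =>
    rw [onWord_cons, List.append_assoc] at h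
    have hocc := (isCompleteReturn_iff.mp (hη.completeReturn i)).2.2.2
    rcases le_or_gt (η i).length s.length with hle | hlt
    · obtain ⟨s', rfl⟩ : η i <+: s :=
        List.prefix_of_prefix_length_le ⟨_, h⟩ ⟨p ++ t, by simp⟩ hle
      obtain ⟨y₁, y₂, rfl, rfl, hy⟩ := ih (s := s') (by simpa using h)
      exact ⟨i :: y₁, y₂, rfl, (onWord_cons η i y₁).symm, hy⟩
    · obtain ⟨r, hr⟩ : s ++ p <+: η i ++ p := by
        obtain ⟨z, hz⟩ := hη.prefix_onWord_append y
        exact List.prefix_of_prefix_length_le ⟨t, h.symm⟩ ⟨z, by rw [List.append_assoc, hz]⟩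
          (by simpa using hlt.le)
      rcases hocc s r hr.symm with rfl | rfl
      · exact ⟨[], i :: y, rfl, rfl, by simpa [onWord_cons] using h⟩
      · rw [List.append_nil] at hr
        exact absurd hlt (by rw [List.append_cancel_right hr]; exact lt_irrefl _)

theorem mem_language_onSeq_iff (hη : IsClassPret η p) {u : ℕ → A} {w : List B} :
    w ∈ language (onSeq η hη.ne_nil u) ↔ ∃ y ∈ language u, w <:+: onWord η y ++ p := by
  constructor
  · intro hw
    obtain ⟨n, hn⟩ := exists_infix_block_zero hw
    refine ⟨block u 0 n, block_mem_language _ _ _, hn.trans (List.IsPrefix.isInfix ?_)⟩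
    have hle := le_length_onWord η 1 (fun i => List.length_pos_iff.mpr (hη.ne_nil i)) (block u 0 n)
    rw [one_mul, length_block] at hle
    obtain ⟨k, hk⟩ := Nat.exists_eq_add_of_le hle
    rw [← block_onSeq_zero hη.ne_nil, hk, block_add, List.append_assoc]
    exact List.prefix_append _ _
  · rintro ⟨y, hy, hw⟩
    obtain ⟨i, hi⟩ := exists_append_singleton_mem_language hy
    obtain ⟨n, hn⟩ := exists_infix_block_zero hi
    have himage : onWord η (y ++ [i]) ∈ language (onSeq η hη.ne_nil u) := by
      refine mem_language_of_infix (z := onWord η (block u 0 n)) ?_ (onWord_infix η hn)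
      rw [← block_onSeq_zero hη.ne_nil]
      exact block_mem_language _ _ _
    refine mem_language_of_infix himage (hw.trans (List.IsPrefix.isInfix ?_))
    rw [onWord_append, onWord_singleton, List.prefix_append_right_inj]
    exact hη.prefix_image i

theorem isClosedUnderReversal_onSeq (hη : IsClassPret η p) {u : ℕ → A}
    (hu : IsClosedUnderReversal u) : IsClosedUnderReversal (onSeq η hη.ne_nil u) := by
  intro w hw
  obtain ⟨y, hy, h⟩ := hη.mem_language_onSeq_iff.mp hw
  refine hη.mem_language_onSeq_iff.mpr ⟨y.reverse, hu y hy, ?_⟩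
  rw [← hη.reverse_onWord_append]
  exact List.reverse_infix.mpr h

theorem exists_eq_framedImage (hη : IsClassPret η p) {u : ℕ → A} {w : List B}
    (hw : w ∈ language (onSeq η hη.ne_nil u)) (hpw : p <:+: w) :
    ∃ s x t, IsLeadIn p s ∧ IsLeadIn p t ∧ w = framedImage η p s x t := by
  obtain ⟨y, -, g, g', hy⟩ := hη.mem_language_onSeq_iff.mp hw
  obtain ⟨s, z, hs, rfl⟩ := exists_isLeadIn hpw
  obtain ⟨t, z', ht, hz⟩ := exists_isLeadIn (p := p) (w := (p ++ z).reverse)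
    ⟨z.reverse, [], by simp [hη.palindrome.reverse_eq]⟩
  have hz' : p ++ z = z'.reverse ++ p ++ t.reverse := by
    simpa [hη.palindrome.reverse_eq] using congrArg List.reverse hz
  obtain ⟨-, y₂, -, -, hy₂⟩ :=
    hη.exists_onWord_eq_of_append_eq (y := y) (s := g ++ s) (t := z ++ g') (by rw [← hy]; simp)
  obtain ⟨x, -, -, hx, -⟩ := hη.exists_onWord_eq_of_append_eq (y := y₂) (s := z'.reverse)
    (t := t.reverse ++ g') (by rw [hy₂, ← List.append_assoc, hz', List.append_assoc])
  exact ⟨s, x, t, hs, ht, by rw [framedImage, ← hx, List.append_assoc, hz']; simp⟩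

theorem reverse_framedImage (hη : IsClassPret η p) (s t : List B) (x : List A) :
    (framedImage η p s x t).reverse = framedImage η p t x.reverse s := by
  have := hη.reverse_onWord_append x
  simp only [framedImage, List.append_assoc, List.reverse_append, List.reverse_reverse] at this ⊢
  rw [← List.append_assoc p.reverse, this, List.append_assoc]

theorem framedImage_eq_lead_in_append (hη : IsClassPret η p) (s t : List B) (x : List A) :
    ∃ z, framedImage η p s x t = s ++ p ++ z := by
  obtain ⟨z, hz⟩ := hη.prefix_onWord_append x
  exact ⟨z ++ t.reverse, by rw [framedImage, List.append_assoc s, ← hz]; simp⟩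

theorem palindrome_framedImage_iff (hη : IsClassPret η p) {s t : List B} (hs : IsLeadIn p s)
    (ht : IsLeadIn p t) {x : List A} :
    (framedImage η p s x t).Palindrome ↔ s = t ∧ x.Palindrome := by
  rw [List.Palindrome.iff_reverse_eq, List.Palindrome.iff_reverse_eq, hη.reverse_framedImage]
  constructor
  · intro h
    obtain ⟨z, hz⟩ := hη.framedImage_eq_lead_in_append s t x
    obtain ⟨z', hz'⟩ := hη.framedImage_eq_lead_in_append t s x.reverse
    obtain rfl := hs.eq ht (by rw [← hz, ← hz', h])
    simp only [framedImage, List.append_assoc, List.append_cancel_left_eq,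
      List.append_cancel_right_eq] at h
    exact ⟨rfl, hη.injective h⟩
  · rintro ⟨rfl, h⟩
    rw [h]

theorem exists_suffix_image (hη : IsClassPret η p) {s : List B} (hs : IsLeadIn p s) {b : B}
    {y : List A} (h : b :: s <:+ onWord η y) : ∃ y' i, y = y' ++ [i] ∧ (b, i) ∈ precedes η s := by
  rcases List.eq_nil_or_concat' y with rfl | ⟨y', i, rfl⟩
  · simp at h
  refine ⟨y', i, rfl, ?_⟩
  rw [onWord_append, onWord_singleton] at h
  rcases le_or_gt (b :: s).length (η i).length with hle | hlt
  · exact List.suffix_of_suffix_length_le h (List.suffix_append _ _) hle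
  · obtain ⟨r, hr⟩ : η i <:+ s :=
      List.suffix_of_suffix_length_le (List.suffix_append _ _) ((List.suffix_cons _ _).trans h)
        (Nat.lt_succ_iff.mp hlt)
    obtain ⟨q, -, hq⟩ := hη.eq_append i
    have := hs r (q ++ p) (by simp [← hr, hq])
    exact absurd (by simp_all) (hη.ne_nil i)

theorem extRel_framedImage (hη : IsClassPret η p) (u : ℕ → A) {s t : List B} (hs : IsLeadIn p s)
    (ht : IsLeadIn p t) (x : List A) :
    extRel (onSeq η hη.ne_nil u) (framedImage η p s x t) =
      contract (precedes η s) (extRel u x) (precedes η t) := by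
  ext ⟨a, b⟩
  rw [mem_contract]
  refine Iff.trans hη.mem_language_onSeq_iff ?_
  constructor
  · rintro ⟨y, hy, g, g', h⟩
    obtain ⟨z, hz⟩ := hη.prefix_onWord_append x
    obtain ⟨y₁, y₂, rfl, hy₁, hy₂⟩ := hη.exists_onWord_eq_of_append_eq (y := y)
      (s := g ++ a :: s) (t := z ++ t.reverse ++ b :: g')
      (by rw [← h, framedImage, List.append_assoc s, ← hz]; simp)
    obtain ⟨y₃, y₄, rfl, hy₃, hy₄⟩ := hη.exists_onWord_eq_of_append_eq (y := y₂)
      (s := onWord η x) (t := t.reverse ++ b :: g') (by rw [hy₂, ← hz]; simp)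
    obtain rfl := hη.injective hy₃
    have hy₄' : onWord η y₄.reverse = g'.reverse ++ b :: t := by
      have := congrArg List.reverse hy₄
      rw [hη.reverse_onWord_append] at this
      exact List.append_cancel_right (this.trans (by simp [hη.palindrome.reverse_eq]))
    obtain ⟨y₁, i, rfl, hi⟩ := hη.exists_suffix_image hs ⟨g, hy₁⟩
    obtain ⟨y₄, j, hj₄, hj⟩ := hη.exists_suffix_image ht ⟨g'.reverse, hy₄'.symm⟩
    obtain rfl := List.reverse_eq_iff.mp hj₄
    exact ⟨i, j, hi, mem_language_of_infix hy ⟨y₁, y₄.reverse, by simp⟩, hj⟩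
  · rintro ⟨i, j, ⟨g, hg⟩, hij, ⟨g', hg'⟩⟩
    refine ⟨_, hij, g, g'.reverse, ?_⟩
    have hj : η j ++ p = p ++ t.reverse ++ b :: g'.reverse := by
      rw [← hη.reverse_image_append, ← hg']
      simp [hη.palindrome.reverse_eq]
    have himage : onWord η (i :: (x ++ [j])) ++ p = η i ++ (onWord η x ++ (η j ++ p)) := by
      simp [onWord_cons, onWord_append]
    rw [himage, hj, framedImage, ← hg]
    simp

end IsClassPret

end Images

/-! ### Regular extension relations -/

section Regular

variable {A B : Type*}

/-- The extension relation of `w` is a looped star if `w` is a palindrome, a double star otherwise.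
Unlike `HasRichOrder`, this property is inherited by images under morphisms of class `P_ret`. -/
def IsRegular (u : ℕ → A) (w : List A) : Prop :=
  (w.Palindrome → ∃ k, IsLoopedStar (extRel u w) k) ∧
    (¬ w.Palindrome → ∃ k m, IsDoubleStar (extRel u w) k m)

theorem IsRegular.hasRichOrder [Finite A] {u : ℕ → A} (hu : IsClosedUnderReversal u) {w : List A}
    (hw : IsBispecial u w) (h : IsRegular u w) : HasRichOrder u w := by
  rw [HasRichOrder, hu.bilateralOrder_eq, ncard_Pext]
  constructor
  · intro hp
    obtain ⟨k, m, hkm⟩ := h.2 hp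
    exact hkm.relOrder_eq
  · intro hp
    obtain ⟨k, hk⟩ := h.1 hp
    exact hk.relOrder_eq (hu.isBispecial_iff.mp hw).1

theorem mem_precedes_of_length_le {η : A → List B} {s t : List B} (hlen : s.length ≤ t.length)
    (hst : s ≠ t) {a : B} {i j : A} (hi : i ∈ (precedes η t).cod) (hj : j ∈ (precedes η t).cod)
    (ha : (a, i) ∈ precedes η s) : (a, j) ∈ precedes η s := by
  obtain ⟨b, hb⟩ := hi
  obtain ⟨c, hc⟩ := hj
  have hlt : s.length ≠ t.length := fun heq => hst <|
    List.tail_eq_of_cons_eq <|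
      (List.suffix_of_suffix_length_le ha hb (by simp [heq])).eq_of_length (by simp [heq])
  have hat : a :: s <:+ t :=
    List.suffix_of_suffix_length_le ha ((List.suffix_cons b t).trans hb)
      (by rw [List.length_cons]; omega)
  exact hat.trans ((List.suffix_cons c t).trans hc)

theorem IsLoopedStar.exists_isDoubleStar_contract_precedes {η : A → List B} {s t : List B}
    {R : SetRel A A} {k : A} (h : IsLoopedStar R k) (hst : s ≠ t)
    (hdom : (contract (precedes η s) R (precedes η t)).dom.Nontrivial)
    (hcod : (contract (precedes η s) R (precedes η t)).cod.Nontrivial) :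
    ∃ a b, IsDoubleStar (contract (precedes η s) R (precedes η t)) a b := by
  rcases le_total s.length t.length with hlen | hlen
  · exact h.exists_isDoubleStar_contract_of_nested (leftUnique_precedes η s)
      (leftUnique_precedes η t) hdom hcod fun _ _ _ => mem_precedes_of_length_le hlen hst
  · have hinv : (contract (precedes η s) R (precedes η t)).inv =
        contract (precedes η t) R (precedes η s) := by rw [inv_contract, h.inv_eq]
    rw [← SetRel.cod_inv, hinv] at hdom
    rw [← SetRel.dom_inv, hinv] at hcod
    obtain ⟨b, a, hba⟩ := h.exists_isDoubleStar_contract_of_nested (leftUnique_precedes η t)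
      (leftUnique_precedes η s) hcod hdom fun _ _ _ => mem_precedes_of_length_le hlen hst.symm
    exact ⟨a, b, by simpa only [← hinv, SetRel.inv_inv] using hba.inv⟩

namespace IsClassPret

variable {η : A → List B} {p : List B}

theorem length_add_length_le_framedImage (hη : IsClassPret η p) (s t : List B) (x : List A) :
    x.length + p.length ≤ (framedImage η p s x t).length := by
  have := le_length_onWord η 1 (fun i => List.length_pos_iff.mpr (hη.ne_nil i)) x
  simp only [framedImage, List.length_append]
  omega

theorem isRegular_framedImage (hη : IsClassPret η p) {u : ℕ → A} {s t : List B} {x : List A}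
    (hs : IsLeadIn p s) (ht : IsLeadIn p t) (hx : IsRegular u x)
    (hdom : (extRel (onSeq η hη.ne_nil u) (framedImage η p s x t)).dom.Nontrivial)
    (hcod : (extRel (onSeq η hη.ne_nil u) (framedImage η p s x t)).cod.Nontrivial) :
    IsRegular (onSeq η hη.ne_nil u) (framedImage η p s x t) := by
  rw [hη.extRel_framedImage u hs ht] at hdom hcod
  rw [IsRegular, hη.extRel_framedImage u hs ht, hη.palindrome_framedImage_iff hs ht]
  constructor
  · rintro ⟨rfl, hxp⟩
    obtain ⟨k, hk⟩ := hx.1 hxp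
    exact hk.exists_isLoopedStar_contract (leftUnique_precedes η s) hdom
  · intro hp
    by_cases hxp : x.Palindrome
    · obtain ⟨k, hk⟩ := hx.1 hxp
      exact hk.exists_isDoubleStar_contract_precedes (fun hst => hp ⟨hst, hxp⟩) hdom hcod
    · obtain ⟨k, m, hkm⟩ := hx.2 hxp
      exact hkm.exists_isDoubleStar_contract (leftUnique_precedes η s) (leftUnique_precedes η t)
        hdom hcod

theorem isRegular (hη : IsClassPret η p) {u : ℕ → A} (hu : IsClosedUnderReversal u) {w : List B}
    (hw : IsBispecial (onSeq η hη.ne_nil u) w) (hpw : p <:+: w)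
    (hreg : ∀ x, x.length + p.length ≤ w.length → IsBispecial u x → IsRegular u x) :
    IsRegular (onSeq η hη.ne_nil u) w := by
  obtain ⟨s, x, t, hs, ht, rfl⟩ := hη.exists_eq_framedImage hw.1.1 hpw
  obtain ⟨hdom, hcod⟩ := (hη.isClosedUnderReversal_onSeq hu).isBispecial_iff.mp hw
  have hx : IsBispecial u x := by
    rw [hu.isBispecial_iff]
    rw [hη.extRel_framedImage u hs ht] at hdom hcod
    rw [← SetRel.dom_inv, inv_contract] at hcod
    rw [← SetRel.dom_inv (R := extRel u x)]
    exact ⟨nontrivial_dom_of_contract (leftUnique_precedes η s) hdom,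
      nontrivial_dom_of_contract (leftUnique_precedes η t) hcod⟩
  exact hη.isRegular_framedImage hs ht
    (hreg x (hη.length_add_length_le_framedImage s t x) hx) hdom hcod

theorem isRich_onSeq [Finite B] (hη : IsClassPret η p) {u : ℕ → A} (hu : IsClosedUnderReversal u)
    (hreg : ∀ x, IsBispecial u x → IsRegular u x)
    (h : ∀ w, IsBispecial (onSeq η hη.ne_nil u) w → ¬ p <:+: w →
      HasRichOrder (onSeq η hη.ne_nil u) w) :
    IsRich (onSeq η hη.ne_nil u) := by
  have hclosed := hη.isClosedUnderReversal_onSeq hu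
  refine hclosed.isRich_of_hasRichOrder fun w hw => ?_
  by_cases hpw : p <:+: w
  · exact (hη.isRegular hu hw hpw fun x _ => hreg x).hasRichOrder hclosed hw
  · exact h w hw hpw

end IsClassPret

end Regular

/-! ### Morphisms marking the beginning of each block -/

section Marked

variable {A B : Type*} {a : B} {t : A → List B}

theorem isLeadIn_singleton {s : List B} (ha : a ∉ s) : IsLeadIn [a] s := by
  intro r r' h
  rcases List.eq_nil_or_concat' r' with rfl | ⟨r', c, rfl⟩
  · rfl
  · have hs : s ++ [a] = r ++ [a] ++ r' ++ [c] := by rw [h, List.append_assoc _ r']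
    exact absurd ((List.append_singleton_inj.mp hs).1 ▸ by simp) ha

theorem exists_onWord_cons_append_eq (a : B) (t : A → List B) (y : List A) :
    ∃ z, onWord (fun i => a :: t i) y ++ [a] = a :: z := by
  cases y with
  | nil => exact ⟨[], rfl⟩
  | cons i y => exact ⟨_, rfl⟩

theorem onWord_cons_injective (ht : Function.Injective t) (ha : ∀ i, a ∉ t i) :
    Function.Injective (onWord fun i => a :: t i) := by
  intro x y h
  induction x generalizing y with
  | nil =>
    cases y with
    | nil => rfl
    | cons j y => exact absurd h (List.cons_ne_nil _ _).symm
  | cons i x ih =>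
    cases y with
    | nil => exact absurd h (List.cons_ne_nil _ _)
    | cons j y =>
      obtain ⟨z, hz⟩ := exists_onWord_cons_append_eq a t x
      obtain ⟨z', hz'⟩ := exists_onWord_cons_append_eq a t y
      have hsplit : t i ++ [a] ++ z = t j ++ [a] ++ z' := by
        simpa [onWord_cons, hz, hz'] using congrArg (· ++ [a]) h
      obtain rfl := ht ((isLeadIn_singleton (ha i)).eq (isLeadIn_singleton (ha j)) hsplit)
      rw [ih (List.append_cancel_left h)]

theorem isClassPret_cons (ht : Function.Injective t) (ha : ∀ i, a ∉ t i)
    (hpal : ∀ i, (t i).Palindrome) : IsClassPret (fun i => a :: t i) [a] where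
  injective := onWord_cons_injective ht ha
  palindrome := List.Palindrome.singleton a
  eq_append i := ⟨t i, hpal i, rfl⟩
  completeReturn i := by
    refine isCompleteReturn_iff.mpr ⟨by simp, ⟨_, rfl⟩, ⟨_, rfl⟩, fun x y h => ?_⟩
    cases x with
    | nil => exact Or.inl rfl
    | cons b x => exact Or.inr (isLeadIn_singleton (ha i) x y (List.cons.inj h).2)

theorem exists_infix_of_infix_onWord_cons {y : List A} {w : List B} (ha : a ∉ w) (hw : w ≠ [])
    (h : w <:+: onWord (fun i => a :: t i) y ++ [a]) : ∃ i, w <:+: t i := by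
  induction y with
  | nil =>
    rcases (List.infix_singleton_iff _ _).mp h with rfl | rfl
    exacts [absurd rfl hw, absurd List.mem_cons_self ha]
  | cons i y ih =>
    obtain ⟨z, hz⟩ := exists_onWord_cons_append_eq a t y
    rw [onWord_cons, List.append_assoc] at h
    have hinfix : w <:+: a :: t i ∨ w <:+: onWord (fun i => a :: t i) y ++ [a] := by
      rcases List.infix_append_iff.mp h with h | h | ⟨w₁, w₂, rfl, h₁, h₂⟩
      · exact Or.inl h
      · exact Or.inr h
      · obtain rfl : w₂ = [] := by
          rw [hz] at h₂
          rcases List.prefix_cons_iff.mp h₂ with h₂ | ⟨w₂, rfl, -⟩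
          exacts [h₂, absurd (by simp) ha]
        exact Or.inl (by simpa using h₁.isInfix)
    rcases hinfix with h | h
    · rcases List.infix_cons_iff.mp h with h | h
      · rcases List.prefix_cons_iff.mp h with rfl | ⟨w, rfl, -⟩
        exacts [absurd rfl hw, absurd List.mem_cons_self ha]
      · exact ⟨i, h⟩
    · exact ih h

end Marked

/-! ### The sequence `u_d` -/

section USeq

variable {d : ℕ} [NeZero d]

theorem phi_eq_cons_tail (i : Fin d) : phi d i = 0 :: (phi d i).tail := by
  unfold phi
  split <;> rfl

theorem tail_phi (i : Fin d) :
    (∃ h : (i : ℕ) + 1 < d, (phi d i).tail = [⟨i + 1, h⟩]) ∨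
      i = ⊤ ∧ (phi d i).tail = [⊤, ⊤] := by
  by_cases h : (i : ℕ) + 1 < d
  · exact Or.inl ⟨h, by simp [phi, h]⟩
  · obtain rfl : i = ⊤ := by
      ext
      rw [Fin.val_top]
      omega
    exact Or.inr ⟨rfl, by rw [phi, dif_neg h]; rfl⟩

theorem tail_phi_injective : Function.Injective fun i : Fin d => (phi d i).tail := by
  intro i j hij
  dsimp only at hij
  rcases tail_phi i with ⟨hi, hti⟩ | ⟨hi, hti⟩ <;>
    rcases tail_phi j with ⟨hj, htj⟩ | ⟨hj, htj⟩ <;> rw [hti, htj] at hij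
  · exact Fin.ext (by simpa using hij)
  · simp at hij
  · simp at hij
  · exact hi.trans hj.symm

theorem zero_notMem_tail_phi (hd : 2 ≤ d) (i : Fin d) : 0 ∉ (phi d i).tail := by
  rcases tail_phi i with ⟨h, htail⟩ | ⟨-, htail⟩
  · simp only [htail, List.mem_singleton, Fin.ext_iff, Fin.val_zero]
    omega
  · simp only [htail, List.mem_cons, List.not_mem_nil, or_false, or_self, Fin.ext_iff, Fin.val_top,
      Fin.val_zero]
    omega

theorem isClassPret_phi (hd : 2 ≤ d) : IsClassPret (phi d) [0] := by
  rw [show phi d = fun i => 0 :: (phi d i).tail from funext phi_eq_cons_tail]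
  refine isClassPret_cons tail_phi_injective (zero_notMem_tail_phi hd) fun i => ?_
  rcases tail_phi i with ⟨h, htail⟩ | ⟨-, htail⟩ <;>
    exact List.Palindrome.of_reverse_eq (by rw [htail]; rfl)

theorem mem_language_uSeq_iff (hd : 3 ≤ d) {w : List (Fin d)} :
    w ∈ language (uSeq d hd) ↔ ∃ y ∈ language (uSeq d hd), w <:+: onWord (phi d) y ++ [0] := by
  have := (isClassPret_phi (by omega)).mem_language_onSeq_iff (u := uSeq d hd) (w := w)
  rwa [onSeq_phi_uSeq] at this

theorem reverse_phiIter_mem_language (hd : 3 ≤ d) (n : ℕ) :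
    (phiIter d hd n).reverse ∈ language (uSeq d hd) := by
  induction n with
  | zero =>
    have hblock : block (uSeq d hd) 0 1 = [0] :=
      (block_uSeq_prefix d hd 0).eq_of_length rfl
    have hmem := block_mem_language (uSeq d hd) 0 1
    rwa [hblock] at hmem
  | succ n ih =>
    refine (mem_language_uSeq_iff hd).mpr ⟨_, ih, ?_⟩
    rw [← (isClassPret_phi (by omega)).reverse_onWord_append, ← phiIter_succ, List.reverse_append]
    exact (List.suffix_append _ _).isInfix

theorem isClosedUnderReversal_uSeq (hd : 3 ≤ d) : IsClosedUnderReversal (uSeq d hd) := by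
  intro w hw
  obtain ⟨n, hn⟩ := exists_infix_block_zero hw
  refine mem_language_of_infix (reverse_phiIter_mem_language hd n) (List.reverse_infix.mpr ?_)
  refine hn.trans (List.IsPrefix.isInfix (List.IsPrefix.trans ?_ (block_uSeq_prefix d hd n)))
  rw [block_succ]
  exact List.prefix_append _ _

theorem length_le_one_or_eq_of_zero_notMem (hd : 3 ≤ d) {w : List (Fin d)}
    (hw : w ∈ language (uSeq d hd)) (h0 : 0 ∉ w) : w.length ≤ 1 ∨ w = [⊤, ⊤] := by
  rcases eq_or_ne w [] with rfl | hne
  · simp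
  obtain ⟨y, -, hy⟩ := (mem_language_uSeq_iff hd).mp hw
  rw [show phi d = fun i => 0 :: (phi d i).tail from funext phi_eq_cons_tail] at hy
  obtain ⟨i, hi⟩ := exists_infix_of_infix_onWord_cons h0 hne hy
  rcases tail_phi i with ⟨h, htail⟩ | ⟨-, htail⟩ <;> rw [htail] at hi
  · exact Or.inl hi.length_le
  · rcases hi.length_le.lt_or_eq with hlt | heq
    · exact Or.inl (Nat.lt_succ_iff.mp hlt)
    · exact Or.inr (hi.eq_of_length heq)

theorem isLoopedStar_extRel_nil (hd : 3 ≤ d) : IsLoopedStar (extRel (uSeq d hd) []) 0 := by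
  have hu := isClosedUnderReversal_uSeq hd
  have htop : ∀ {i j : Fin d}, (i, j) ∈ extRel (uSeq d hd) [] → i ≠ 0 → j ≠ 0 →
      i = ⊤ ∧ j = ⊤ := by
    intro i j hij hi hj
    have := length_le_one_or_eq_of_zero_notMem hd hij (by simp [hi.symm, hj.symm])
    simpa using this
  refine ⟨fun i j hij => ?_, fun i j hij => ?_, fun i hii hi => ?_,
    fun i j hii hjj hi hj => (htop hii hi hi).1.trans (htop hjj hj hj).1.symm⟩
  · rwa [← hu.inv_extRel_of_palindrome .nil]
  · by_contra! h
    obtain ⟨rfl, rfl⟩ := htop hij h.2.1 h.2.2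
    exact h.1 rfl
  · obtain ⟨a, ha⟩ := hu.exists_cons_mem_language hii
    obtain rfl : a = 0 := by
      by_contra ha0
      simpa using length_le_one_or_eq_of_zero_notMem hd ha (by simp [hi.symm, Ne.symm ha0])
    exact mem_language_of_infix ha ⟨[], [i], rfl⟩

theorem isLoopedStar_extRel_top (hd : 3 ≤ d) : IsLoopedStar (extRel (uSeq d hd) [⊤]) 0 := by
  have hu := isClosedUnderReversal_uSeq hd
  have hedge : ∀ {i j : Fin d}, (i, j) ∈ extRel (uSeq d hd) [⊤] → i = 0 ∨ j = 0 := by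
    intro i j hij
    by_contra! h
    have htop : (0 : Fin d) ≠ ⊤ := by
      rw [Ne, Fin.ext_iff, Fin.val_zero, Fin.val_top]
      omega
    have h0 : 0 ∉ i :: ([⊤] ++ [j]) := by simp [h.1.symm, h.2.symm, htop]
    simpa using length_le_one_or_eq_of_zero_notMem hd hij h0
  refine ⟨fun i j hij => ?_, fun i j hij => Or.inr (hedge hij),
    fun i hii hi => absurd (hedge hii) (by simpa using hi),
    fun i j hii _ hi => absurd (hedge hii) (by simpa using hi)⟩
  rwa [← hu.inv_extRel_of_palindrome (.singleton _)]

theorem eq_nil_or_eq_top_of_isBispecial (hd : 3 ≤ d) {w : List (Fin d)}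
    (hw : IsBispecial (uSeq d hd) w) (h0 : 0 ∉ w) : w = [] ∨ w = [⊤] := by
  obtain ⟨a, haw, ha⟩ :=
    ((isClosedUnderReversal_uSeq hd).isBispecial_iff.mp hw).1.exists_ne 0
  rcases length_le_one_or_eq_of_zero_notMem hd (mem_dom_extRel.mp haw)
    (by simp [ha.symm, h0]) with hlen | heq
  · exact Or.inl (List.length_eq_zero_iff.mp (Nat.le_zero.mp (Nat.succ_le_succ_iff.mp hlen)))
  · exact Or.inr (List.cons.inj heq).2

theorem isRegular_uSeq (hd : 3 ≤ d) {w : List (Fin d)} (hw : IsBispecial (uSeq d hd) w) :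
    IsRegular (uSeq d hd) w := by
  induction hn : w.length using Nat.strong_induction_on generalizing w with
  | _ n ih =>
    by_cases h0 : 0 ∈ w
    · have hreg := (isClassPret_phi (by omega)).isRegular (isClosedUnderReversal_uSeq hd) (w := w)
      rw [onSeq_phi_uSeq] at hreg
      refine hreg hw ((List.singleton_infix_iff _ _).mpr h0) fun x hx hxb => ?_
      rw [List.length_singleton] at hx
      exact ih x.length (by omega) hxb rfl
    · rcases eq_nil_or_eq_top_of_isBispecial hd hw h0 with rfl | rfl
      · exact ⟨fun _ => ⟨0, isLoopedStar_extRel_nil hd⟩, fun h => absurd .nil h⟩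
      · exact ⟨fun _ => ⟨0, isLoopedStar_extRel_top hd⟩, fun h => absurd (.singleton _) h⟩

end USeq

end RichWords

theorem mainTheorem5 (d : ℕ) (hd : 3 ≤ d) {B : Type*} [Finite B]
    (η : Fin d → List B) (p : List B) (hη : RichWords.IsClassPret η p)
    (hb : ∀ w : List B,
      RichWords.IsBispecial (RichWords.onSeq η hη.ne_nil (RichWords.uSeq d hd)) w →
      ¬ p <:+: w →
        (¬ w.Palindrome →
          RichWords.bilateralOrder (RichWords.onSeq η hη.ne_nil (RichWords.uSeq d hd)) w = 0) ∧
        (w.Palindrome →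
          RichWords.bilateralOrder (RichWords.onSeq η hη.ne_nil (RichWords.uSeq d hd)) w =
            ((RichWords.Pext (RichWords.onSeq η hη.ne_nil (RichWords.uSeq d hd)) w).ncard : ℤ)
              - 1)) :
    RichWords.IsRich (RichWords.onSeq η hη.ne_nil (RichWords.uSeq d hd)) := by
  have : NeZero d := ⟨by omega⟩
  exact hη.isRich_onSeq (RichWords.isClosedUnderReversal_uSeq hd)
    (fun _ hx => RichWords.isRegular_uSeq hd hx) hb
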